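/- Let $n\ge 0$ and let $K\subset 2^{[n]}$ be a simplicial complex (if $A\subset B\in K$ then $A\in K$) with vertex set $[n]$ (that is, $\{i\}\in K$ for every $i\in[n]$) which is Alexander self-dual: for every $A\subset[n]$, one has $A\in K$ if and only if $[n]\setminus A\notin K$. (These conditions force $n\ge 3$.) A configuration $(p_1,\dots,p_n)\in(\mathbb{CP}^1)^n$ is called stable if $I\in K$ for every $I\subset[n]$ such that the points $p_i$, $i\in I$, all coincide. Let $STABLE(K)\subset(\mathbb{CP}^1)^n$ be the set of stable configurations and let $$\overline{\mathcal M}_{0,K}=STABLE(K)/\mathrm{PSL}_2(\mathbb C)$$ be the quotient by the diagonal action. Equip it with the quotient of the classical topology and of the sheaf of holomorphic functions of $STABLE(K)$ (a function on an open set is holomorphic iff its pullback to $STABLE(K)$ is), and also with the quotient of the Zariski topology and of the sheaf of regular functions of $STABLE(K)$ (a function on a Zariski open set is regular iff its pullback is). Then: 1. in the classical topology $\overline{\mathcal M}_{0,K}$ is compact, Hausdorff and second countable, and it is a complex manifold of dimension $n-3$ whose holomorphic functions are those just described; 2. with its Zariski topology and regular functions, $\overline{\mathcal M}_{0,K}$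 is a smooth (irreducible, separated) complex algebraic variety of dimension $n-3$; 3. for distinct $i,j,k\in[n]$ let $U_{i,j,k}\subset\overline{\mathcal M}_{0,K}$ be the set of classes of configurations for which $p_i,p_j,p_k$ are pairwise distinct. The sets $U_{i,j,k}$ cover $\overline{\mathcal M}_{0,K}$. Each is open (in both topologies), and normalizing $p_i=0$, $p_j=1$, $p_k=\infty$ identifies $U_{i,j,k}$, both as an algebraic variety and as a complex manifold, with the set of those $(p_l)_{l\ne i,j,k}\in(\mathbb{CP}^1)^{n-3}$ for which the configuration with $p_i=0$, $p_j=1$, $p_k=\infty$ is stable; this set is open in $(\mathbb{CP}^1)^{n-3}$ (in both topologies). -/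

import Mathlib

open scoped LinearAlgebra.Projectivization MatrixGroups Manifold ContDiff Topology

noncomputable section

/-! ### Spaces with functions

A variety, or a complex manifold, is described by a topological space together with its sheaf of
(regular, or holomorphic) complex-valued functions. -/

/-- A space with functions: a topology on `X` and, for every open `U`, an algebra of functions on
`U`, forming a sheaf. A function on `U` is represented by any of its extensions to a
total function `X → ℂ`; by `congr` only its values on `U` matter. -/
structure SpaceWithFunctions (X : Type*) where
  /-- the topology -/
  top : TopologicalSpace X
  /-- the algebra of functions on `U` (only used for open `U`) -/
  regular : Set X → Subalgebra ℂ (X → ℂ)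
  congr : ∀ {U : Set X} {f g : X → ℂ}, Set.EqOn f g U → f ∈ regular U → g ∈ regular U
  restrict : ∀ {U V : Set X}, U ⊆ V → regular V ≤ regular U
  glue : ∀ {U : Set X} {f : X → ℂ}, IsOpen[top] U →
    (∀ x ∈ U, ∃ V, IsOpen[top] V ∧ x ∈ V ∧ V ⊆ U ∧ f ∈ regular V) → f ∈ regular U

namespace SpaceWithFunctions

variable {X Y : Type*}

/-- The Zariski topology on affine space: the principal open sets `{P ≠ 0}` generate it. -/
abbrev zariskiTopology (σ : Type*) : TopologicalSpace (σ → ℂ) :=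
  TopologicalSpace.generateFrom
    {U | ∃ P : MvPolynomial σ ℂ, U = {x | MvPolynomial.eval x P ≠ 0}}

/-- Affine space over `ℂ` as a variety: Zariski topology, and functions that are locally
quotients of polynomials with nonvanishing denominator. -/
def affine (σ : Type*) : SpaceWithFunctions (σ → ℂ) where
  top := zariskiTopology σ
  regular U :=
    { carrier := {f | ∀ x ∈ U, ∃ V, IsOpen[zariskiTopology σ] V ∧ x ∈ V ∧
        ∃ P G : MvPolynomial σ ℂ, ∀ y ∈ V, y ∈ U →
          MvPolynomial.eval y G ≠ 0 ∧ f y = MvPolynomial.eval y P / MvPolynomial.eval y G}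
      mul_mem' := by
        intro f g hf hg x hx
        obtain ⟨V, hV, hxV, P, G, h⟩ := hf x hx
        obtain ⟨V', hV', hxV', P', G', h'⟩ := hg x hx
        refine ⟨V ∩ V', (zariskiTopology σ).isOpen_inter _ _ hV hV', ⟨hxV, hxV'⟩,
          P * P', G * G', fun y hy hyU => ?_⟩
        obtain ⟨h1, h2⟩ := h y hy.1 hyU
        obtain ⟨h3, h4⟩ := h' y hy.2 hyU
        simp only [map_mul, Pi.mul_apply]
        exact ⟨mul_ne_zero h1 h3, by rw [h2, h4]; field_simp⟩
      add_mem' := by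
        intro f g hf hg x hx
        obtain ⟨V, hV, hxV, P, G, h⟩ := hf x hx
        obtain ⟨V', hV', hxV', P', G', h'⟩ := hg x hx
        refine ⟨V ∩ V', (zariskiTopology σ).isOpen_inter _ _ hV hV', ⟨hxV, hxV'⟩,
          P * G' + P' * G, G * G', fun y hy hyU => ?_⟩
        obtain ⟨h1, h2⟩ := h y hy.1 hyU
        obtain ⟨h3, h4⟩ := h' y hy.2 hyU
        simp only [map_mul, map_add, Pi.add_apply]
        exact ⟨mul_ne_zero h1 h3, by rw [h2, h4]; field_simp⟩
      algebraMap_mem' := fun r x _ =>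
        ⟨Set.univ, @isOpen_univ _ (zariskiTopology σ), trivial, MvPolynomial.C r, 1,
          fun y _ _ => by simp⟩ }
  congr := by
    intro U f g hfg hf x hx
    obtain ⟨V, hV, hxV, P, G, h⟩ := hf x hx
    exact ⟨V, hV, hxV, P, G, fun y hy hyU => by rw [← hfg hyU]; exact h y hy hyU⟩
  restrict := by
    intro U V hUV f hf x hx
    obtain ⟨W, hW, hxW, P, G, h⟩ := hf x (hUV hx)
    exact ⟨W, hW, hxW, P, G, fun y hy hyU => h y hy (hUV hyU)⟩
  glue := by
    intro U f _ h x hx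
    obtain ⟨V, hV, hxV, _, hf⟩ := h x hx
    obtain ⟨W, hW, hxW, P, G, h'⟩ := hf x hxV
    exact ⟨V ∩ W, (zariskiTopology σ).isOpen_inter _ _ hV hW, ⟨hxV, hxW⟩, P, G,
      fun y hy _ => h' y hy.2 hy.1⟩

/-- The complex manifold `ℂ^σ`: the usual topology and the holomorphic functions. -/
def holomorphic (σ : Type*) [Fintype σ] : SpaceWithFunctions (σ → ℂ) where
  top := inferInstance
  regular U :=
    { carrier := {f | DifferentiableOn ℂ f U}
      mul_mem' := fun hf hg => DifferentiableOn.mul hf hg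
      add_mem' := fun hf hg => DifferentiableOn.add hf hg
      algebraMap_mem' := fun r => differentiableOn_const r }
  congr := fun hfg hf => DifferentiableOn.congr hf fun _ hx => (hfg hx).symm
  restrict := fun hUV _ hf => DifferentiableOn.mono hf hUV
  glue := by
    intro U f _ h x hx
    obtain ⟨V, hV, hxV, _, hf⟩ := h x hx
    exact ((hf x hxV).differentiableAt (hV.mem_nhds hxV)).differentiableWithinAt

/-- The structure induced along `j : Y → X` (used for inclusions of subsets): the induced topology,
and the functions that locally extend to functions of the ambient space. -/
def comap (j : Y → X) (S : SpaceWithFunctions X) : SpaceWithFunctions Y where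
  top := S.top.induced j
  regular W :=
    { carrier := {f | ∀ a ∈ W, ∃ V, IsOpen[S.top] V ∧ j a ∈ V ∧ ∃ g ∈ S.regular V,
        ∀ b ∈ W, j b ∈ V → f b = g (j b)}
      mul_mem' := by
        intro f f' hf hf' a ha
        obtain ⟨V, hV, haV, g, hg, h⟩ := hf a ha
        obtain ⟨V', hV', haV', g', hg', h'⟩ := hf' a ha
        refine ⟨V ∩ V', S.top.isOpen_inter _ _ hV hV', ⟨haV, haV'⟩, g * g',
          mul_mem (S.restrict Set.inter_subset_left hg) (S.restrict Set.inter_subset_right hg'),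
          fun b hb hbV => ?_⟩
        simp only [Pi.mul_apply, h b hb hbV.1, h' b hb hbV.2]
      add_mem' := by
        intro f f' hf hf' a ha
        obtain ⟨V, hV, haV, g, hg, h⟩ := hf a ha
        obtain ⟨V', hV', haV', g', hg', h'⟩ := hf' a ha
        refine ⟨V ∩ V', S.top.isOpen_inter _ _ hV hV', ⟨haV, haV'⟩, g + g',
          add_mem (S.restrict Set.inter_subset_left hg) (S.restrict Set.inter_subset_right hg'),
          fun b hb hbV => ?_⟩
        simp only [Pi.add_apply, h b hb hbV.1, h' b hb hbV.2]
      algebraMap_mem' := fun r a _ =>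
        ⟨Set.univ, @isOpen_univ _ S.top, trivial, algebraMap ℂ (X → ℂ) r,
          Subalgebra.algebraMap_mem _ r, fun _ _ _ => rfl⟩ }
  congr := by
    intro U f f' hff hf a ha
    obtain ⟨V, hV, haV, g, hg, h⟩ := hf a ha
    exact ⟨V, hV, haV, g, hg, fun b hb hbV => by rw [← hff hb]; exact h b hb hbV⟩
  restrict := by
    intro U V hUV f hf a ha
    obtain ⟨W, hW, haW, g, hg, h⟩ := hf a (hUV ha)
    exact ⟨W, hW, haW, g, hg, fun b hb => h b (hUV hb)⟩
  glue := by
    intro U f _ h a ha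
    obtain ⟨W, hW, haW, _, hf⟩ := h a ha
    obtain ⟨O, hO, rfl⟩ := (@isOpen_induced_iff _ _ S.top _ _).1 hW
    obtain ⟨V, hV, haV, g, hg, h'⟩ := hf a haW
    exact ⟨O ∩ V, S.top.isOpen_inter _ _ hO hV, ⟨haW, haV⟩, g,
      S.restrict Set.inter_subset_right hg, fun b _ hbV => h' b hbV.1 hbV.2⟩

/-- The quotient structure along `q : X → Y` (used for surjections): the quotient topology, and the
functions whose pullback along `q` is a function of the structure on `X`. -/
def map (q : X → Y) (S : SpaceWithFunctions X) : SpaceWithFunctions Y where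
  top := S.top.coinduced q
  regular U :=
    { carrier := {f | f ∘ q ∈ S.regular (q ⁻¹' U)}
      mul_mem' := fun hf hg => mul_mem (S := Subalgebra ℂ (X → ℂ)) hf hg
      add_mem' := fun hf hg => add_mem (S := Subalgebra ℂ (X → ℂ)) hf hg
      algebraMap_mem' := fun r => Subalgebra.algebraMap_mem (S.regular (q ⁻¹' U)) r }
  congr := fun {_ _ _} hfg hf => S.congr (fun _ hx => hfg hx) hf
  restrict := fun {_ _} hUV _ hf => S.restrict (Set.preimage_mono hUV) hf
  glue := by
    intro U f hU h
    refine S.glue (isOpen_coinduced.1 hU) fun x hx => ?_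
    obtain ⟨V, hV, hxV, hVU, hf⟩ := h (q x) hx
    exact ⟨q ⁻¹' V, isOpen_coinduced.1 hV, hxV, Set.preimage_mono hVU, hf⟩

/-- `φ` is an isomorphism of `X` onto an open subspace of `Y`. -/
structure IsOpenImmersion (S : SpaceWithFunctions X) (T : SpaceWithFunctions Y) (φ : X → Y) :
    Prop where
  isOpenEmbedding : @Topology.IsOpenEmbedding X Y S.top T.top φ
  regular_iff : ∀ W : Set Y, IsOpen[T.top] W → W ⊆ Set.range φ → ∀ f : Y → ℂ,
    f ∈ T.regular W ↔ f ∘ φ ∈ S.regular (φ ⁻¹' W)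

/-- The affine piece `{F₁ = … = F_c = 0, H ≠ 0}` of affine space. -/
def locus {σ : Type*} {c : ℕ} (F : Fin c → MvPolynomial σ ℂ) (H : MvPolynomial σ ℂ) :
    Set (σ → ℂ) :=
  {y | (∀ a, MvPolynomial.eval y (F a) = 0) ∧ MvPolynomial.eval y H ≠ 0}

/-- The Jacobian criterion: the gradients of the `c` equations are linearly independent at every
point of the locus, which is therefore smooth of codimension `c`. -/
def IsSmoothLocus {σ : Type*} {c : ℕ} (F : Fin c → MvPolynomial σ ℂ) (H : MvPolynomial σ ℂ) :
    Prop :=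
  ∀ y ∈ locus F H, LinearIndependent ℂ
    fun a : Fin c => fun s : σ => MvPolynomial.eval y (MvPolynomial.pderiv s (F a))

/-- Separatedness: the diagonal is closed in the product variety `X × X`. The open subsets of the
product are generated by the sets `{(u, v) ∈ U × V | ∑ f_a(u) g_a(v) ≠ 0}`, where `f_a` is regular
on `U` and `g_a` is regular on `V`. -/
def IsSeparated (S : SpaceWithFunctions X) : Prop :=
  ∀ x y : X, x ≠ y → ∃ U V : Set X, IsOpen[S.top] U ∧ IsOpen[S.top] V ∧ x ∈ U ∧ y ∈ V ∧
    ∃ (m : ℕ) (f g : Fin m → X → ℂ), (∀ a, f a ∈ S.regular U) ∧ (∀ a, g a ∈ S.regular V) ∧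
      ∑ a, f a x * g a y ≠ 0 ∧ ∀ z ∈ U ∩ V, ∑ a, f a z * g a z = 0

/-- `S` is a smooth complex algebraic variety of dimension `d`: quasi-compact, irreducible,
separated, and locally isomorphic to affine varieties of dimension `d` that are
smooth by the Jacobian criterion. -/
structure IsSmoothVariety (S : SpaceWithFunctions X) (d : ℕ) : Prop where
  quasiCompact : @CompactSpace X S.top
  irreducible : @IrreducibleSpace X S.top
  separated : S.IsSeparated
  smooth : ∀ x : X, ∃ (c : ℕ) (F : Fin c → MvPolynomial (Fin (c + d)) ℂ)
    (H : MvPolynomial (Fin (c + d)) ℂ), IsSmoothLocus F H ∧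
    ∃ φ : locus F H → X, x ∈ Set.range φ ∧
      IsOpenImmersion ((affine (Fin (c + d))).comap Subtype.val) S φ

end SpaceWithFunctions

/-! ### Simplicial complexes and stable configurations

A simplicial complex on `[n]` is a hereditary family of finite subsets (`LowerSet`). -/

/-- The Alexander dual `{A | Aᶜ ∉ K}`. -/
def alexanderDual {n : ℕ} (K : LowerSet (Finset (Fin n))) : LowerSet (Finset (Fin n)) where
  carrier := {A | Aᶜ ∉ K}
  lower' := fun _ _ hBA hA hB => hA (K.lower (Finset.compl_subset_compl.2 hBA) hB)

/-- `K` is Alexander self-dual. -/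
def IsAlexanderSelfDual {n : ℕ} (K : LowerSet (Finset (Fin n))) : Prop := alexanderDual K = K

/-- The complex projective line. -/
abbrev ProjLine : Type := ℙ ℂ (Fin 2 → ℂ)

namespace ProjLine

/-- The point `0 = [0 : 1]`. -/
def zero : ProjLine := Projectivization.mk ℂ ![0, 1] (by simp)

/-- The point `1 = [1 : 1]`. -/
def one : ProjLine := Projectivization.mk ℂ ![1, 1] (by simp)

/-- The point `∞ = [1 : 0]`. -/
def infty : ProjLine := Projectivization.mk ℂ ![1, 0] (by simp)

end ProjLine

/-- Families of homogeneous coordinates `(x_i, y_i) ≠ (0, 0)`, `i ∈ ι`. -/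
def homogCoords (ι : Type*) : Set (ι × Fin 2 → ℂ) := {v | ∀ i, (fun s => v (i, s)) ≠ 0}

/-- The quotient map `(ℂ² ∖ 0)^ι → (ℂP¹)^ι`. -/
def homogCoords.toConfig {ι : Type*} (v : homogCoords ι) : ι → ProjLine :=
  fun i => Projectivization.mk ℂ (fun s => v.1 (i, s)) (v.2 i)

/-- The algebraic variety `(ℂP¹)^ι`, as the quotient of `(ℂ² ∖ 0)^ι` by the torus `(ℂˣ)^ι`. -/
def algConfig (ι : Type*) : SpaceWithFunctions (ι → ProjLine) :=
  ((SpaceWithFunctions.affine (ι × Fin 2)).comap Subtype.val).map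
    (homogCoords.toConfig (ι := ι))

/-- The complex manifold `(ℂP¹)^ι`, as the quotient of `(ℂ² ∖ 0)^ι` by the torus `(ℂˣ)^ι`. -/
def holConfig (ι : Type*) [Fintype ι] : SpaceWithFunctions (ι → ProjLine) :=
  ((SpaceWithFunctions.holomorphic (ι × Fin 2)).comap Subtype.val).map
    (homogCoords.toConfig (ι := ι))

/-- The space of `K`-stable configurations, with the diagonal action of `PSL(2, ℂ)`:
the index set of each collection of coinciding points is a face of `K`. -/
def Stable {n : ℕ} (K : LowerSet (Finset (Fin n))) :
    SubMulAction PSL(2, ℂ) (Fin n → ProjLine) where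
  carrier := {p | ∀ I : Finset (Fin n), (∀ i ∈ I, ∀ j ∈ I, p i = p j) → I ∈ K}
  smul_mem' := fun g _ hp I hI =>
    hp I fun i hi j hj => MulAction.injective g (hI i hi j hj)

/-- The space `STABLE(K) / PSL(2, ℂ)`. -/
def ModuliSpace {n : ℕ} (K : LowerSet (Finset (Fin n))) : Type :=
  MulAction.orbitRel.Quotient PSL(2, ℂ) (Stable K)

namespace ModuliSpace

variable {n : ℕ} (K : LowerSet (Finset (Fin n)))

/-- The class of a stable configuration modulo `PSL(2, ℂ)`. -/
def mk (p : Stable K) : ModuliSpace K :=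
  Quotient.mk (MulAction.orbitRel PSL(2, ℂ) (Stable K)) p

/-- The natural algebraic structure: the quotient of the subspace `STABLE(K)` of the variety
`(ℂP¹)^n`. -/
def alg : SpaceWithFunctions (ModuliSpace K) :=
  ((algConfig (Fin n)).comap (fun p : Stable K => p.1)).map (mk K)

/-- The natural complex-analytic structure: the quotient of the subspace `STABLE(K)` of
the complex manifold `(ℂP¹)^n`. -/
def hol : SpaceWithFunctions (ModuliSpace K) :=
  ((holConfig (Fin n)).comap (fun p : Stable K => p.1)).map (mk K)

/-- The moduli space carries the classical quotient topology. -/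
instance : TopologicalSpace (ModuliSpace K) := (hol K).top

/-- The set `U_{i,j,k}` of classes of configurations with `p_i, p_j, p_k` pairwise distinct. -/
def distinctLocus (i j k : Fin n) : Set (ModuliSpace K) :=
  {x | ∃ p : Stable K, mk K p = x ∧ p.1 i ≠ p.1 j ∧ p.1 j ≠ p.1 k ∧ p.1 i ≠ p.1 k}

/-- The configuration with `p_i = 0`, `p_j = 1`, `p_k = ∞` and the remaining points given by `w`. -/
def normalized (i j k : Fin n) (w : {l : Fin n // l ≠ i ∧ l ≠ j ∧ l ≠ k} → ProjLine) :
    Fin n → ProjLine :=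
  fun l =>
    if hi : l = i then ProjLine.zero
    else if hj : l = j then ProjLine.one
    else if hk : l = k then ProjLine.infty
    else w ⟨l, hi, hj, hk⟩

/-- The positions of the remaining `n - 3` points for which the normalized
configuration is stable. -/
def normalizedSet (i j k : Fin n) : Set ({l : Fin n // l ≠ i ∧ l ≠ j ∧ l ≠ k} → ProjLine) :=
  {w | normalized i j k w ∈ Stable K}

/-- The class of the stable configuration with `p_i = 0`, `p_j = 1`, `p_k = ∞` and the remaining
points given by `w`. -/
def chart (i j k : Fin n) (w : normalizedSet K i j k) : ModuliSpace K :=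
  mk K ⟨normalized i j k w.1, w.2⟩

end ModuliSpace

end

/-! Self-duality says that of a set of indices and its complement exactly one is a face. This enters
three times.

Charts. A stable configuration takes at least three values, since with at most two a fibre and its
complement would both be faces (`exists_mem_distinct`). Moving three distinct points to `0`, `1`,
`∞` gives a slice meeting each such orbit once. The inverse is given by cross ratios, which are
polynomial in homogeneous coordinates and invariant under the group. So `U_{i,j,k}` is an open piece
of a product of lines (`isLocalChart_normalized`).

Separatedness. Stable `v`, `w` lie in one orbit iff some invertible `A` makes `v_i` parallel to `A
w_i` for all `i`. These are linear equations in the four entries of `A`. A solution of rank one is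
impossible: the `v_i` with `A w_i ≠ 0` coincide in the image line, and the remaining `w_i` coincide
in the kernel, so complementary sets would both be faces (`det_ne_zero_of_wedge_eq_zero`). Hence the
orbit relation is the vanishing of the 4×4 minors of the matrix with rows `v_i ⊗ w_i`, and each
minor is a sum of products of a function of `v` and a function of `w`.

Compactness. Along an ultrafilter, unit homogeneous vectors converge. If the limit is unstable, a
non-face `I` has collapsed to a point. Zoom in on it until its spread is `1`; the indices outside
`I`, which form a face, then collapse to `∞`. A non-face still collapsed cannot sit at `∞`, so it is
a proper subset of `I`, and induction on its size ends at a stable limit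
(`exists_stable_limit_of_cluster`).

The arguments common to varieties and complex manifolds are carried out once, for any structure on
the spaces `ℂ^σ` satisfying `IsGeometry`. -/

namespace SpaceWithFunctions

/-! ### Morphisms, quotients and local charts of spaces with functions. -/

section Morphisms

variable {X Y Z W : Type*} {R : SpaceWithFunctions W} {S : SpaceWithFunctions X}
  {T : SpaceWithFunctions Y}

/-- `φ` restricts to a morphism from the open subspace `U` of `X` to `Y`. -/
structure IsMorphismOn (S : SpaceWithFunctions X) (T : SpaceWithFunctions Y) (φ : X → Y)
    (U : Set X) : Prop where
  isOpen_inter_preimage : ∀ V, IsOpen[T.top] V → IsOpen[S.top] (U ∩ φ ⁻¹' V)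
  comp_mem : ∀ V, IsOpen[T.top] V → ∀ h ∈ T.regular V, h ∘ φ ∈ S.regular (U ∩ φ ⁻¹' V)

theorem isOpen_of_local {U : Set X}
    (h : ∀ x ∈ U, ∃ V, IsOpen[S.top] V ∧ x ∈ V ∧ V ⊆ U) : IsOpen[S.top] U := by
  let _ := S.top
  refine isOpen_iff_forall_mem_open.2 fun x hx => ?_
  obtain ⟨V, h1, h2, h3⟩ := h x hx
  exact ⟨V, h3, h1, h2⟩

namespace IsMorphismOn

variable {φ φ' : X → Y} {U U' : Set X}

theorem isOpen (h : IsMorphismOn S T φ U) : IsOpen[S.top] U := by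
  simpa using h.isOpen_inter_preimage Set.univ (@isOpen_univ _ T.top)

theorem comp {ψ : Y → W} {V : Set Y} (hψ : IsMorphismOn T R ψ V) (hφ : IsMorphismOn S T φ U) :
    IsMorphismOn S R (ψ ∘ φ) (U ∩ φ ⁻¹' V) where
  isOpen_inter_preimage O hO := by
    have := hφ.isOpen_inter_preimage _ (hψ.isOpen_inter_preimage O hO)
    rwa [Set.preimage_inter, ← Set.inter_assoc] at this
  comp_mem O hO h hh := by
    have := hφ.comp_mem _ (hψ.isOpen_inter_preimage O hO) _ (hψ.comp_mem O hO h hh)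
    rwa [Set.preimage_inter, ← Set.inter_assoc] at this

theorem mono (h : IsMorphismOn S T φ U) (hU' : IsOpen[S.top] U') (hsub : U' ⊆ U) :
    IsMorphismOn S T φ U' where
  isOpen_inter_preimage O hO := by
    have := S.top.isOpen_inter _ _ hU' (h.isOpen_inter_preimage O hO)
    rwa [← Set.inter_assoc, Set.inter_eq_left.2 hsub] at this
  comp_mem O hO f hf :=
    S.restrict (Set.inter_subset_inter_left _ hsub) (h.comp_mem O hO f hf)

theorem congr (h : IsMorphismOn S T φ U) (he : Set.EqOn φ φ' U) : IsMorphismOn S T φ' U := by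
  have key (O : Set Y) : U ∩ φ ⁻¹' O = U ∩ φ' ⁻¹' O := by
    ext x
    simp only [Set.mem_inter_iff, Set.mem_preimage]
    exact and_congr_right fun hx => by rw [he hx]
  refine ⟨fun O hO => key O ▸ h.isOpen_inter_preimage O hO, fun O hO f hf => ?_⟩
  rw [← key O]
  exact S.congr (fun x hx => by simp [he hx.1]) (h.comp_mem O hO f hf)

theorem of_local
    (h : ∀ x ∈ U, ∃ V, x ∈ V ∧ V ⊆ U ∧ IsMorphismOn S T φ V) : IsMorphismOn S T φ U := by
  have key (O : Set Y) (hO : IsOpen[T.top] O) : IsOpen[S.top] (U ∩ φ ⁻¹' O) := by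
    refine isOpen_of_local fun x hx => ?_
    obtain ⟨V, hxV, hVU, hV⟩ := h x hx.1
    exact ⟨_, hV.isOpen_inter_preimage O hO, ⟨hxV, hx.2⟩, Set.inter_subset_inter_left _ hVU⟩
  refine ⟨key, fun O hO f hf => S.glue (key O hO) fun x hx => ?_⟩
  obtain ⟨V, hxV, hVU, hV⟩ := h x hx.1
  exact ⟨_, hV.isOpen_inter_preimage O hO, ⟨hxV, hx.2⟩, Set.inter_subset_inter_left _ hVU,
    hV.comp_mem O hO f hf⟩

theorem comap_left (j : Y → X) : IsMorphismOn (S.comap j) S j Set.univ where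
  isOpen_inter_preimage O hO := by
    rw [Set.univ_inter]
    exact ⟨O, hO, rfl⟩
  comp_mem O hO f hf x hx := ⟨O, hO, hx.2, f, hf, fun _ _ _ => rfl⟩

/-- A map from an open subspace is a morphism if its restriction to the subspace is one. -/
theorem of_comap {j : Z → X} (hrange : IsOpen[S.top] (Set.range j))
    (h : IsMorphismOn (S.comap j) T (φ ∘ j) Set.univ) : IsMorphismOn S T φ (Set.range j) := by
  have key (O : Set Y) (hO : IsOpen[T.top] O) : IsOpen[S.top] (Set.range j ∩ φ ⁻¹' O) := by
    obtain ⟨O', hO', he⟩ := h.isOpen_inter_preimage O hO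
    have : Set.range j ∩ φ ⁻¹' O = Set.range j ∩ O' := by
      ext x
      refine and_congr_right ?_
      rintro ⟨z, rfl⟩
      have := Set.ext_iff.1 he z
      simpa using this.symm
    rw [this]
    exact S.top.isOpen_inter _ _ hrange hO'
  refine ⟨key, fun O hO f hf => S.glue (key O hO) ?_⟩
  rintro _ ⟨⟨z, rfl⟩, hx⟩
  obtain ⟨V, hV, hzV, g, hg, hgf⟩ := h.comp_mem O hO f hf z ⟨trivial, hx⟩
  refine ⟨_, S.top.isOpen_inter _ _ (key O hO) hV, ⟨⟨⟨z, rfl⟩, hx⟩, hzV⟩,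
    Set.inter_subset_left, S.congr ?_ (S.restrict Set.inter_subset_right hg)⟩
  rintro _ ⟨⟨⟨b, rfl⟩, hb⟩, hbV⟩
  exact (hgf b ⟨trivial, hb⟩ hbV).symm

end IsMorphismOn

/-- `q` exhibits `Y` as the quotient of the open subspace `U` of `X`. -/
structure IsQuotientOn (S : SpaceWithFunctions X) (T : SpaceWithFunctions Y) (q : X → Y)
    (U : Set X) : Prop extends IsMorphismOn S T q U where
  isOpen_of_preimage : ∀ V, IsOpen[S.top] (U ∩ q ⁻¹' V) → IsOpen[T.top] V
  mem_of_comp : ∀ V, IsOpen[T.top] V → ∀ f, f ∘ q ∈ S.regular (U ∩ q ⁻¹' V) → f ∈ T.regular V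

namespace IsQuotientOn

variable {q : X → Y} {U : Set X}

theorem comp {q' : Y → W} {V : Set Y} (h' : IsQuotientOn T R q' V) (h : IsQuotientOn S T q U) :
    IsQuotientOn S R (q' ∘ q) (U ∩ q ⁻¹' V) where
  toIsMorphismOn := h'.toIsMorphismOn.comp h.toIsMorphismOn
  isOpen_of_preimage O hO := by
    refine h'.isOpen_of_preimage _ (h.isOpen_of_preimage _ ?_)
    rwa [Set.preimage_inter, ← Set.inter_assoc]
  mem_of_comp O hO f hf := by
    refine h'.mem_of_comp _ hO _ (h.mem_of_comp _ (h'.isOpen_inter_preimage O hO) _ ?_)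
    rwa [Set.preimage_inter, ← Set.inter_assoc]

/-- Universal property of the quotient: regularity of a map out of `Y` is checked upstairs, where
the map has explicit formulas in homogeneous coordinates. -/
theorem descend (h : IsQuotientOn S T q U) {ψ : Y → W} {V : Set Y}
    (hψ : IsMorphismOn S R (ψ ∘ q) (U ∩ q ⁻¹' V)) : IsMorphismOn T R ψ V := by
  have key (O : Set W) (hO : IsOpen[R.top] O) : IsOpen[T.top] (V ∩ ψ ⁻¹' O) := by
    refine h.isOpen_of_preimage _ ?_
    have := hψ.isOpen_inter_preimage O hO
    rwa [Set.inter_assoc] at this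
  refine ⟨key, fun O hO f hf => h.mem_of_comp _ (key O hO) _ ?_⟩
  have := hψ.comp_mem O hO f hf
  rwa [Set.inter_assoc] at this

/-- The quotient of an open subspace of `X`, described by a map defined on all of `X`. -/
theorem of_comap_map {j : Z → X} {q' : Z → Y} (hrange : IsOpen[S.top] (Set.range j))
    (hq : q ∘ j = q') : IsQuotientOn S ((S.comap j).map q') q (Set.range j) := by
  subst hq
  have hmor : IsMorphismOn S ((S.comap j).map (q ∘ j)) q (Set.range j) := by
    refine IsMorphismOn.of_comap hrange ⟨fun O hO => ?_, fun O hO f hf => ?_⟩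
    · rw [Set.univ_inter]
      exact isOpen_coinduced.1 hO
    · rw [Set.univ_inter]
      exact hf
  refine ⟨hmor, fun V hV => ?_, fun V hV f hf z hz => ?_⟩
  · refine isOpen_coinduced.2 ⟨_, hV, ?_⟩
    ext z
    simp
  · exact ⟨_, hmor.isOpen_inter_preimage V hV, ⟨⟨z, rfl⟩, hz⟩, _, hf, fun _ _ _ => rfl⟩

end IsQuotientOn

/-- `φ` is an isomorphism of the open subspace `V` of `X` onto an open subspace of `Y`, with
inverse `ρ`. -/
structure IsLocalChart (S : SpaceWithFunctions X) (T : SpaceWithFunctions Y) (V : Set X)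
    (φ : X → Y) (ρ : Y → X) : Prop where
  morphism : IsMorphismOn S T φ V
  inverse : IsMorphismOn T S ρ (φ '' V)
  left_inv : ∀ x ∈ V, ρ (φ x) = x

namespace IsLocalChart

variable {φ : X → Y} {ρ : Y → X} {V V' : Set X}

theorem image_eq (h : IsLocalChart S T V φ ρ) (hsub : V' ⊆ V) :
    φ '' V' = φ '' V ∩ ρ ⁻¹' V' := by
  ext y
  constructor
  · rintro ⟨x, hx, rfl⟩
    exact ⟨⟨x, hsub hx, rfl⟩, by rwa [Set.mem_preimage, h.left_inv x (hsub hx)]⟩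
  · rintro ⟨⟨x, hx, rfl⟩, hy⟩
    rw [Set.mem_preimage, h.left_inv x hx] at hy
    exact ⟨x, hy, rfl⟩

theorem mono (h : IsLocalChart S T V φ ρ) (hV' : IsOpen[S.top] V') (hsub : V' ⊆ V) :
    IsLocalChart S T V' φ ρ where
  morphism := h.morphism.mono hV' hsub
  inverse := by
    refine h.inverse.mono ?_ (Set.image_mono hsub)
    rw [h.image_eq hsub]
    exact h.inverse.isOpen_inter_preimage _ hV'
  left_inv x hx := h.left_inv x (hsub hx)

theorem comp {φ' : Y → W} {ρ' : W → Y} {O : Set Y} (h' : IsLocalChart T R O φ' ρ')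
    (h : IsLocalChart S T V φ ρ) : IsLocalChart S R (V ∩ φ ⁻¹' O) (φ' ∘ φ) (ρ ∘ ρ') where
  morphism := h'.morphism.comp h.morphism
  inverse := by
    have hO := h.inverse.mono
      (T.top.isOpen_inter _ _ h.inverse.isOpen h'.morphism.isOpen) Set.inter_subset_left
    have := hO.comp h'.inverse
    convert this using 1
    rw [Set.image_comp, Set.image_inter_preimage, h'.image_eq (V' := φ '' V ∩ O)
      Set.inter_subset_right]
  left_inv x hx := by
    simp only [Function.comp_apply]
    rw [h'.left_inv _ hx.2, h.left_inv _ hx.1]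

theorem isOpenImmersion (h : IsLocalChart S T V φ ρ) :
    IsOpenImmersion (S.comap (Subtype.val : V → X)) T (fun x => φ x.1) where
  isOpenEmbedding := by
    let _ := (S.comap (Subtype.val : V → X)).top
    let _ := T.top
    have hm : IsMorphismOn (S.comap (Subtype.val : V → X)) T (φ ∘ Subtype.val) Set.univ :=
      (h.morphism.comp (IsMorphismOn.comap_left (S := S) Subtype.val)).mono
        (@isOpen_univ _ (S.comap (Subtype.val : V → X)).top) fun x _ => ⟨trivial, x.2⟩
    refine Topology.IsOpenEmbedding.of_continuous_injective_isOpenMap ?_ ?_ ?_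
    · exact continuous_def.2 fun O hO => by
        have := hm.isOpen_inter_preimage O hO
        rwa [Set.univ_inter] at this
    · intro x y hxy
      have := congrArg ρ hxy
      simp only [h.left_inv _ x.2, h.left_inv _ y.2] at this
      exact Subtype.ext this
    · rintro _ ⟨O, hO, rfl⟩
      have := h.inverse.isOpen_inter_preimage _ (S.top.isOpen_inter _ _ h.morphism.isOpen hO)
      rw [← h.image_eq Set.inter_subset_left] at this
      convert this using 1
      ext y
      constructor
      · rintro ⟨x, hx, rfl⟩
        exact ⟨x.1, ⟨x.2, hx⟩, rfl⟩
      · rintro ⟨x, hx, rfl⟩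
        exact ⟨⟨x, hx.1⟩, hx.2, rfl⟩
  regular_iff O hO hsub f := by
    have hrange : Set.range (fun x : V => φ x.1) = φ '' V := by
      ext; simp
    rw [hrange] at hsub
    constructor
    · intro hf
      have := ((h.morphism.comp (IsMorphismOn.comap_left (S := S)
        (Subtype.val : V → X)))).comp_mem O hO f hf
      refine SpaceWithFunctions.restrict _ ?_ this
      intro x hx
      exact ⟨⟨trivial, x.2⟩, hx⟩
    · intro hf
      refine T.glue hO fun y hy => ?_
      obtain ⟨x, hx, rfl⟩ := hsub hy
      obtain ⟨N, hN, hxN, g, hg, hgf⟩ := hf ⟨x, hx⟩ hy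
      -- On the part of the image that `ρ` sends into the domain `N` of the local extension `g`, the
      -- function `f` equals `g ∘ ρ`.
      refine ⟨O ∩ (φ '' V ∩ ρ ⁻¹' N), T.top.isOpen_inter _ _ hO
        (h.inverse.isOpen_inter_preimage N hN), ⟨hy, ⟨x, hx, rfl⟩, ?_⟩, Set.inter_subset_left, ?_⟩
      · rwa [Set.mem_preimage, h.left_inv x hx]
      · refine T.congr ?_ (T.restrict Set.inter_subset_right (h.inverse.comp_mem N hN g hg))
        rintro _ ⟨hz, ⟨z, hzV, rfl⟩, hzN⟩
        rw [Set.mem_preimage, h.left_inv z hzV] at hzN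
        have := hgf ⟨z, hzV⟩ hz hzN
        simp only [Function.comp_apply, h.left_inv z hzV] at this ⊢
        exact this.symm

end IsLocalChart

end Morphisms

/-! ### What algebraic and holomorphic geometry have in common. -/

section Geometry

/-- Every family of functions that is regular on an open set is a morphism into the
model space of the geometry `G`. -/
def HasCoordinates (G : (σ : Type) → [Fintype σ] → SpaceWithFunctions (σ → ℂ)) {X : Type*}
    (S : SpaceWithFunctions X) : Prop :=
  ∀ (σ : Type) [Fintype σ] (U : Set X), IsOpen[S.top] U → ∀ f : X → σ → ℂ,
    (∀ s, (fun x => f x s) ∈ S.regular U) → IsMorphismOn S (G σ) f U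

/-- A choice of structures on the spaces `ℂ^σ` that behaves like the algebraic, or the complex
analytic, one. -/
structure IsGeometry (G : (σ : Type) → [Fintype σ] → SpaceWithFunctions (σ → ℂ)) : Prop where
  hasCoordinates : ∀ (σ : Type) [Fintype σ], HasCoordinates G (G σ)
  coord_mem : ∀ (σ : Type) [Fintype σ] (s : σ), (fun x => x s) ∈ (G σ).regular Set.univ
  isOpen_ne_zero : IsOpen[(G Unit).top] {x | x () ≠ 0}
  inv_mem : (fun x => (x ())⁻¹) ∈ (G Unit).regular {x | x () ≠ 0}

variable {G : (σ : Type) → [Fintype σ] → SpaceWithFunctions (σ → ℂ)} {X Y : Type*}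
  {S : SpaceWithFunctions X} {T : SpaceWithFunctions Y}

/-- Each coordinate extends locally to the ambient space; as `σ` is finite, the domains of these
extensions have an open intersection, on which all the coordinates extend together. -/
theorem HasCoordinates.comap (h : HasCoordinates G S) (j : Y → X) :
    HasCoordinates G (S.comap j) := by
  intro σ _ U hU f hf
  refine IsMorphismOn.of_local fun a ha => ?_
  choose V hV haV g hg hgf using fun s => hf s a ha
  have hO : IsOpen[S.top] (⋂ s, V s) := by
    let _ := S.top
    exact isOpen_iInter_of_finite hV
  have hm := h σ _ hO (fun x s => g s x) fun s => S.restrict (Set.iInter_subset V s) (hg s)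
  have hm' := hm.comp (IsMorphismOn.comap_left (S := S) j)
  refine ⟨U ∩ j ⁻¹' ⋂ s, V s, ⟨ha, Set.mem_iInter.2 haV⟩, Set.inter_subset_left, ?_⟩
  refine (hm'.mono ((S.comap j).top.isOpen_inter _ _ hU ?_) ?_).congr ?_
  · exact ⟨_, hO, rfl⟩
  · exact fun x hx => ⟨trivial, hx.2⟩
  · intro x hx
    funext s
    exact (hgf s x hx.1 (Set.mem_iInter.1 hx.2 s)).symm

theorem HasCoordinates.map (h : HasCoordinates G S) (q : X → Y) : HasCoordinates G (S.map q) := by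
  intro σ _ U hU f hf
  have := h σ (q ⁻¹' U) (isOpen_coinduced.1 hU) (f ∘ q) hf
  exact ⟨fun O hO => isOpen_coinduced.2 (this.isOpen_inter_preimage O hO), this.comp_mem⟩

namespace IsGeometry

variable (hG : IsGeometry G) (hS : HasCoordinates G S)
include hG

theorem coord_comp_mem {σ : Type} [Fintype σ] {f : X → σ → ℂ} {U : Set X}
    (hf : IsMorphismOn S (G σ) f U) (s : σ) : (fun x => f x s) ∈ S.regular U := by
  have := hf.comp_mem Set.univ (@isOpen_univ _ (G σ).top) _ (hG.coord_mem σ s)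
  rwa [Set.preimage_univ, Set.inter_univ] at this

include hS

theorem isOpen_ne {U : Set X} (hU : IsOpen[S.top] U) {f : X → ℂ} (hf : f ∈ S.regular U) :
    IsOpen[S.top] (U ∩ {x | f x ≠ 0}) :=
  (hS Unit U hU (fun x _ => f x) fun _ => hf).isOpen_inter_preimage _ hG.isOpen_ne_zero

theorem inv_comp_mem {U : Set X} (hU : IsOpen[S.top] U) {f : X → ℂ} (hf : f ∈ S.regular U) :
    (fun x => (f x)⁻¹) ∈ S.regular (U ∩ {x | f x ≠ 0}) :=
  (hS Unit U hU (fun x _ => f x) fun _ => hf).comp_mem _ hG.isOpen_ne_zero _ hG.inv_mem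

end IsGeometry

theorem isGeometry_holomorphic : IsGeometry @holomorphic where
  hasCoordinates τ _ σ _ U hU f hf := by
    have hd : DifferentiableOn ℂ f U := differentiableOn_pi.2 hf
    refine ⟨fun O hO => hd.continuousOn.isOpen_inter_preimage hU hO, fun O hO h hh => ?_⟩
    exact DifferentiableOn.comp hh (hd.mono Set.inter_subset_left) fun x hx => hx.2
  coord_mem σ _ s := (differentiable_apply s).differentiableOn
  isOpen_ne_zero := (isOpen_ne_fun (continuous_apply ()) continuous_const)
  inv_mem := (differentiable_apply ()).differentiableOn.inv fun _ hx => hx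

theorem eval_comp_mem {σ : Type*} {U : Set X} {f : X → σ → ℂ}
    (hf : ∀ s, (fun x => f x s) ∈ S.regular U) (P : MvPolynomial σ ℂ) :
    (fun x => MvPolynomial.eval (f x) P) ∈ S.regular U := by
  induction P using MvPolynomial.induction_on with
  | C a =>
    simp only [MvPolynomial.eval_C]
    exact Subalgebra.algebraMap_mem (S.regular U) a
  | add p q hp hq =>
    simp only [map_add]
    exact add_mem hp hq
  | mul_X p s hp =>
    simp only [map_mul, MvPolynomial.eval_X]
    exact mul_mem hp (hf s)

theorem mem_affine_regular_of_eval {σ : Type*} (P : MvPolynomial σ ℂ) (U : Set (σ → ℂ)) :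
    (fun x => MvPolynomial.eval x P) ∈ (affine σ).regular U :=
  fun _ _ => ⟨Set.univ, @isOpen_univ _ (zariskiTopology σ), trivial, P, 1, by simp⟩

theorem isOpen_zariski_ne {σ : Type*} (P : MvPolynomial σ ℂ) :
    IsOpen[zariskiTopology σ] {x | MvPolynomial.eval x P ≠ 0} :=
  TopologicalSpace.isOpen_generateFrom_of_mem ⟨P, rfl⟩

/-- Nonvanishing loci are open and reciprocals are regular, so that maps with regular coordinates
are morphisms into affine space. -/
theorem hasCoordinates_affine
    (hne : ∀ U, IsOpen[S.top] U → ∀ f ∈ S.regular U, IsOpen[S.top] (U ∩ {x | f x ≠ 0}))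
    (hinv : ∀ U, IsOpen[S.top] U → ∀ f ∈ S.regular U,
      (fun x => (f x)⁻¹) ∈ S.regular (U ∩ {x | f x ≠ 0})) :
    HasCoordinates (fun σ => affine σ) S := by
  intro σ _ U hU f hf
  have key (O : Set (σ → ℂ)) (hO : IsOpen[zariskiTopology σ] O) :
      IsOpen[S.top] (U ∩ f ⁻¹' O) := by
    induction hO with
    | basic O hO =>
      obtain ⟨P, rfl⟩ := hO
      exact hne U hU _ (eval_comp_mem hf P)
    | univ => simpa using hU
    | inter A B _ _ hA hB =>
      rw [Set.preimage_inter, Set.inter_inter_distrib_left]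
      exact S.top.isOpen_inter _ _ hA hB
    | sUnion A _ hA =>
      rw [Set.preimage_sUnion, Set.inter_iUnion₂]
      let _ := S.top
      exact isOpen_biUnion hA
  refine ⟨key, fun O hO h hh => S.glue (key O hO) fun x hx => ?_⟩
  obtain ⟨V, hV, hxV, P, Q, hPQ⟩ := hh (f x) hx.2
  have hQ : (fun x => MvPolynomial.eval (f x) Q) ∈ S.regular U := eval_comp_mem hf Q
  refine ⟨_, key _ ((zariskiTopology σ).isOpen_inter _ _ hV hO), ⟨hx.1, hxV, hx.2⟩,
    fun y hy => ⟨hy.1, hy.2.2⟩, ?_⟩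
  refine S.congr ?_ (S.restrict (V := U ∩ {x | MvPolynomial.eval (f x) Q ≠ 0}) ?_
    (mul_mem (S.restrict Set.inter_subset_left (eval_comp_mem hf P)) (hinv U hU _ hQ)))
  · intro y hy
    simp [(hPQ _ hy.2.1 hy.2.2).2, div_eq_mul_inv]
  · exact fun y hy => ⟨hy.1, (hPQ _ hy.2.1 hy.2.2).1⟩

theorem isGeometry_affine : IsGeometry (fun σ => affine σ) where
  hasCoordinates τ _ := by
    -- Where `f = P / Q`, it is nonzero exactly where `P` is, and there its reciprocal is `Q / P`.
    -- This yields both the open nonvanishing locus and the regular inverse.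
    have key (U : Set (τ → ℂ)) (hU : IsOpen[zariskiTopology τ] U) (f : (τ → ℂ) → ℂ)
        (hf : f ∈ (affine τ).regular U) (x : τ → ℂ) (hx : x ∈ U ∩ {x | f x ≠ 0}) :
        ∃ V, IsOpen[zariskiTopology τ] V ∧ x ∈ V ∧ V ⊆ U ∩ {x | f x ≠ 0} ∧
          ∃ P Q : MvPolynomial τ ℂ, ∀ y ∈ V, MvPolynomial.eval y P ≠ 0 ∧
            (f y)⁻¹ = MvPolynomial.eval y Q / MvPolynomial.eval y P := by
      obtain ⟨V, hV, hxV, P, Q, hPQ⟩ := hf x hx.1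
      refine ⟨V ∩ U ∩ {x | MvPolynomial.eval x P ≠ 0},
        (zariskiTopology τ).isOpen_inter _ _ ((zariskiTopology τ).isOpen_inter _ _ hV hU)
          (isOpen_zariski_ne P), ⟨⟨hxV, hx.1⟩, ?_⟩, ?_, P, Q, ?_⟩
      · intro h0
        apply hx.2
        rw [(hPQ x hxV hx.1).2, h0, zero_div]
      · rintro y ⟨⟨hyV, hyU⟩, hy⟩
        refine ⟨hyU, ?_⟩
        rw [Set.mem_ofPred_eq, (hPQ y hyV hyU).2]
        exact div_ne_zero hy (hPQ y hyV hyU).1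
      · rintro y ⟨⟨hyV, hyU⟩, hy⟩
        exact ⟨hy, by rw [(hPQ y hyV hyU).2, inv_div]⟩
    refine hasCoordinates_affine (fun U hU f hf => ?_) (fun U hU f hf x hx => ?_)
    · refine isOpen_of_local fun x hx => ?_
      obtain ⟨V, h1, h2, h3, -⟩ := key U hU f hf x hx
      exact ⟨V, h1, h2, h3⟩
    · obtain ⟨V, h1, h2, h3, P, Q, h⟩ := key U hU f hf x hx
      exact ⟨V, h1, h2, Q, P, fun y hy _ => h y hy⟩
  coord_mem σ _ s := by simpa using mem_affine_regular_of_eval (MvPolynomial.X s) Set.univ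
  isOpen_ne_zero := by
    have := isOpen_zariski_ne (MvPolynomial.X (R := ℂ) ())
    simp only [MvPolynomial.eval_X] at this
    exact this
  inv_mem := fun _ _ => ⟨Set.univ, @isOpen_univ _ (zariskiTopology Unit), trivial, 1,
    MvPolynomial.X (), fun y _ hy => ⟨by simpa using hy, by simp⟩⟩

/-- Principal open sets are stable under finite intersection, by multiplying polynomials, so the
generating family is a basis. -/
theorem exists_basic_subset {σ : Type*} {U : Set (σ → ℂ)} (hU : IsOpen[zariskiTopology σ] U)
    {x : σ → ℂ} (hx : x ∈ U) : ∃ P : MvPolynomial σ ℂ, MvPolynomial.eval x P ≠ 0 ∧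
      {y | MvPolynomial.eval y P ≠ 0} ⊆ U := by
  induction hU with
  | basic O hO =>
    obtain ⟨P, rfl⟩ := hO
    exact ⟨P, hx, subset_rfl⟩
  | univ => exact ⟨1, by simp, Set.subset_univ _⟩
  | inter A B _ _ hA hB =>
    obtain ⟨P, hP, hPA⟩ := hA hx.1
    obtain ⟨Q, hQ, hQB⟩ := hB hx.2
    refine ⟨P * Q, by simp [hP, hQ], fun y hy => ?_⟩
    simp only [map_mul, ne_eq, mul_eq_zero, not_or, Set.mem_ofPred_eq] at hy
    exact ⟨hPA hy.1, hQB hy.2⟩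
  | sUnion A _ hA =>
    obtain ⟨V, hV, hxV⟩ := hx
    obtain ⟨P, hP, hPV⟩ := hA V hV hxV
    exact ⟨P, hP, hPV.trans (Set.subset_sUnion_of_mem hV)⟩

/-- Polynomials over `ℂ` form a domain, and a nonzero one has a nonzero value. This is the source of
irreducibility of the moduli space. -/
theorem zariski_inter_nonempty {σ : Type*} {U V : Set (σ → ℂ)}
    (hU : IsOpen[zariskiTopology σ] U) (hV : IsOpen[zariskiTopology σ] V)
    (hU' : U.Nonempty) (hV' : V.Nonempty) : (U ∩ V).Nonempty := by
  obtain ⟨x, hx⟩ := hU'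
  obtain ⟨y, hy⟩ := hV'
  obtain ⟨P, hP, hPU⟩ := exists_basic_subset hU hx
  obtain ⟨Q, hQ, hQV⟩ := exists_basic_subset hV hy
  have hPQ : P * Q ≠ 0 := mul_ne_zero (by rintro rfl; simp at hP) (by rintro rfl; simp at hQ)
  by_contra hne
  refine hPQ (MvPolynomial.funext fun z => ?_)
  by_contra hz
  simp only [map_mul, map_zero, mul_eq_zero, not_or] at hz
  exact hne ⟨z, hPU hz.1, hQV hz.2⟩

end Geometry

end SpaceWithFunctions

/-! ### The projective line, its powers and the moduli space in homogeneous coordinates. -/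

noncomputable section

namespace SpaceWithFunctions.IsGeometry

variable {G : (σ : Type) → [Fintype σ] → SpaceWithFunctions (σ → ℂ)} (hG : IsGeometry G)
include hG

theorem coord_mem' {σ : Type} [Fintype σ] (s : σ) (U : Set (σ → ℂ)) :
    (fun x => x s) ∈ (G σ).regular U :=
  (G σ).restrict (Set.subset_univ U) (hG.coord_mem σ s)

/-- A map whose coordinates are regular everywhere is a morphism. -/
theorem isMorphismOn {σ τ : Type} [Fintype σ] [Fintype τ] {f : (τ → ℂ) → σ → ℂ}
    (hf : ∀ s, (fun x => f x s) ∈ (G τ).regular Set.univ) :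
    IsMorphismOn (G τ) (G σ) f Set.univ :=
  hG.hasCoordinates τ σ Set.univ (@isOpen_univ _ (G τ).top) f hf

theorem isOpen_ne_of_mem {σ : Type} [Fintype σ] {f : (σ → ℂ) → ℂ}
    (hf : f ∈ (G σ).regular Set.univ) : IsOpen[(G σ).top] {x | f x ≠ 0} := by
  simpa using hG.isOpen_ne (hG.hasCoordinates σ) (@isOpen_univ _ (G σ).top) hf

end SpaceWithFunctions.IsGeometry

open SpaceWithFunctions

namespace ProjLine

/-- The point with homogeneous coordinates `v`, with the junk value `0` at `v = 0`. -/
def ofVec (v : Fin 2 → ℂ) : ProjLine :=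
  open Classical in if h : v ≠ 0 then Projectivization.mk ℂ v h else zero

/-- The determinant of two vectors of `ℂ²`. -/
def wedge (u v : Fin 2 → ℂ) : ℂ := u 0 * v 1 - u 1 * v 0

theorem ofVec_of_ne {v : Fin 2 → ℂ} (h : v ≠ 0) : ofVec v = Projectivization.mk ℂ v h :=
  dif_pos h

@[simp] theorem ofVec_rep (p : ProjLine) : ofVec p.rep = p := by
  rw [ofVec_of_ne p.rep_nonzero, Projectivization.mk_rep]

theorem ofVec_zero_one : ofVec ![0, 1] = zero := ofVec_of_ne _

theorem ofVec_one_one : ofVec ![1, 1] = one := ofVec_of_ne _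

theorem ofVec_one_zero : ofVec ![1, 0] = infty := ofVec_of_ne _

theorem ofVec_smul {c : ℂ} (hc : c ≠ 0) (v : Fin 2 → ℂ) : ofVec (c • v) = ofVec v := by
  by_cases h : v = 0
  · simp [h]
  · rw [ofVec_of_ne h, ofVec_of_ne (smul_ne_zero hc h), Projectivization.mk_eq_mk_iff']
    exact ⟨c, rfl⟩

theorem exists_smul_of_ofVec_eq {u v : Fin 2 → ℂ} (hu : u ≠ 0) (hv : v ≠ 0)
    (h : ofVec u = ofVec v) : ∃ c : ℂ, c ≠ 0 ∧ u = c • v := by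
  rw [ofVec_of_ne hu, ofVec_of_ne hv, Projectivization.mk_eq_mk_iff'] at h
  obtain ⟨c, rfl⟩ := h
  exact ⟨c, fun h0 => hu (by simp [h0]), rfl⟩

/-- Makes coincidence of points a polynomial condition, so that `{p | p i ≠ p j}` is open in every
geometry. -/
theorem wedge_eq_zero_iff {u v : Fin 2 → ℂ} (hu : u ≠ 0) (hv : v ≠ 0) :
    wedge u v = 0 ↔ ofVec u = ofVec v := by
  constructor
  · intro h
    rw [wedge, sub_eq_zero] at h
    by_cases h0 : v 0 = 0
    · have h1 : v 1 ≠ 0 := fun h1 => hv (by ext i; fin_cases i <;> simpa)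
      have hu0 : u 0 = 0 := by simpa [h0, h1] using h
      have hu1 : u 1 ≠ 0 := fun h1 => hu (by ext i; fin_cases i <;> simpa)
      have : u = (u 1 / v 1) • v := by
        ext i
        fin_cases i
        · simp [hu0, h0]
        · simp [h1]
      rw [this, ofVec_smul (div_ne_zero hu1 h1)]
    · have hu0 : u 0 ≠ 0 := by
        intro hu0
        have hu1 : u 1 = 0 := by simpa [hu0, h0] using h.symm
        exact hu (by ext i; fin_cases i <;> simpa)
      have : u = (u 0 / v 0) • v := by
        ext i
        fin_cases i
        · simp [h0]
        · simp only [Fin.mk_one, Pi.smul_apply, smul_eq_mul]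
          field_simp
          linear_combination -h
      rw [this, ofVec_smul (div_ne_zero hu0 h0)]
  · intro h
    obtain ⟨c, -, rfl⟩ := exists_smul_of_ofVec_eq hu hv h
    simp only [wedge, Pi.smul_apply, smul_eq_mul]
    ring

theorem mulVec_ne_zero {A : Matrix (Fin 2) (Fin 2) ℂ} (hA : A.det ≠ 0) {v : Fin 2 → ℂ}
    (hv : v ≠ 0) : A.mulVec v ≠ 0 :=
  fun h => hv (Matrix.eq_zero_of_mulVec_eq_zero hA h)

theorem specialLinear_smul_ofVec (A : Matrix.SpecialLinearGroup (Fin 2) ℂ) {v : Fin 2 → ℂ}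
    (hv : v ≠ 0) : (QuotientGroup.mk A : PSL(2, ℂ)) • ofVec v = ofVec (A.1.mulVec v) := by
  have hv' : A.1.mulVec v ≠ 0 := mulVec_ne_zero (by simp) hv
  rw [ofVec_of_ne hv, ofVec_of_ne hv']
  rfl

/-- Every element of `PSL(2, ℂ)` acts through an invertible matrix. -/
theorem exists_matrix (g : PSL(2, ℂ)) : ∃ A : Matrix (Fin 2) (Fin 2) ℂ, A.det ≠ 0 ∧
    ∀ v : Fin 2 → ℂ, v ≠ 0 → g • ofVec v = ofVec (A.mulVec v) := by
  obtain ⟨A, rfl⟩ := QuotientGroup.mk_surjective g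
  exact ⟨A.1, by simp, fun v hv => specialLinear_smul_ofVec A hv⟩

/-- Every invertible matrix acts through an element of `PSL(2, ℂ)`. -/
theorem exists_psl {A : Matrix (Fin 2) (Fin 2) ℂ} (hA : A.det ≠ 0) :
    ∃ g : PSL(2, ℂ), ∀ v : Fin 2 → ℂ, v ≠ 0 → g • ofVec v = ofVec (A.mulVec v) := by
  -- Dividing by a square root of the determinant makes the matrix unimodular without changing its
  -- action on points.
  obtain ⟨c, hc⟩ := IsAlgClosed.exists_pow_nat_eq A.det (n := 2) (by norm_num)
  have hc0 : c ≠ 0 := by rintro rfl; exact hA (by rw [← hc]; simp)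
  have hdet : (c⁻¹ • A).det = 1 := by
    rw [Matrix.det_smul, Fintype.card_fin, ← hc, ← mul_pow, inv_mul_cancel₀ hc0, one_pow]
  let B : Matrix.SpecialLinearGroup (Fin 2) ℂ := ⟨c⁻¹ • A, hdet⟩
  refine ⟨QuotientGroup.mk B, fun v hv => (specialLinear_smul_ofVec B hv).trans ?_⟩
  rw [show B.1.mulVec v = c⁻¹ • A.mulVec v from Matrix.smul_mulVec _ _ _,
    ofVec_smul (inv_ne_zero hc0)]

instance : Infinite ProjLine := by
  refine Infinite.of_injective (fun c : ℂ => ofVec ![c, 1]) fun a b h => ?_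
  have hne (c : ℂ) : ![c, 1] ≠ 0 := fun h => by simpa using congrFun h 1
  simpa [wedge, sub_eq_zero] using (wedge_eq_zero_iff (hne a) (hne b)).2 h

end ProjLine

open ProjLine

/-- The configuration with homogeneous coordinates `v`. -/
def configOfVec {ι : Type*} (v : ι × Fin 2 → ℂ) : ι → ProjLine :=
  fun i => ofVec fun s => v (i, s)

/-- A choice of homogeneous coordinates. -/
def vecOfConfig {ι : Type*} (p : ι → ProjLine) : ι × Fin 2 → ℂ := fun a => (p a.1).rep a.2

theorem configOfVec_vecOfConfig {ι : Type*} (p : ι → ProjLine) :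
    configOfVec (vecOfConfig p) = p := by
  funext i
  exact ofVec_rep (p i)

theorem vecOfConfig_mem {ι : Type*} (p : ι → ProjLine) : vecOfConfig p ∈ homogCoords ι :=
  fun i => (p i).rep_nonzero

/-- The space `(ℂP¹)^ι` in the geometry `G`. -/
def config (G : (σ : Type) → [Fintype σ] → SpaceWithFunctions (σ → ℂ)) (ι : Type) [Fintype ι] :
    SpaceWithFunctions (ι → ProjLine) :=
  ((G (ι × Fin 2)).comap Subtype.val).map (homogCoords.toConfig (ι := ι))

namespace SpaceWithFunctions.IsGeometry

variable {G : (σ : Type) → [Fintype σ] → SpaceWithFunctions (σ → ℂ)} (hG : IsGeometry G)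
include hG

theorem isOpen_homogCoords (ι : Type) [Fintype ι] :
    IsOpen[(G (ι × Fin 2)).top] (homogCoords ι) := by
  have : homogCoords ι = ⋂ i, ⋃ s, {v : ι × Fin 2 → ℂ | v (i, s) ≠ 0} := by
    ext v
    simp [homogCoords, funext_iff, imp_iff_not_or]
  rw [this]
  let _ := (G (ι × Fin 2)).top
  exact isOpen_iInter_of_finite fun i => isOpen_iUnion fun s =>
    hG.isOpen_ne_of_mem (hG.coord_mem _ (i, s))

theorem hasCoordinates_config (ι : Type) [Fintype ι] : HasCoordinates G (config G ι) :=
  ((hG.hasCoordinates _).comap _).map _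

theorem isQuotientOn_configOfVec (ι : Type) [Fintype ι] :
    IsQuotientOn (G (ι × Fin 2)) (config G ι) configOfVec (homogCoords ι) := by
  have h := IsQuotientOn.of_comap_map (S := G (ι × Fin 2)) (j := (Subtype.val : homogCoords ι → _))
    (q := configOfVec) (q' := homogCoords.toConfig (ι := ι))
    (by rw [Subtype.range_coe]; exact hG.isOpen_homogCoords ι)
    (by funext v i; exact ofVec_of_ne (v.2 i))
  rwa [Subtype.range_coe] at h

theorem wedge_mem {ι : Type} [Fintype ι] (i j : ι) :
    (fun v : ι × Fin 2 → ℂ => wedge (fun s => v (i, s)) (fun s => v (j, s))) ∈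
      (G (ι × Fin 2)).regular Set.univ :=
  sub_mem (mul_mem (hG.coord_mem _ (i, 0)) (hG.coord_mem _ (j, 1)))
    (mul_mem (hG.coord_mem _ (i, 1)) (hG.coord_mem _ (j, 0)))

theorem isOpen_config_ne {ι : Type} [Fintype ι] (i j : ι) :
    IsOpen[(config G ι).top] {p | p i ≠ p j} := by
  refine (hG.isQuotientOn_configOfVec ι).isOpen_of_preimage _ ?_
  have h : homogCoords ι ∩ configOfVec ⁻¹' {p | p i ≠ p j} = homogCoords ι ∩
      {v | wedge (fun s => v (i, s)) (fun s => v (j, s)) ≠ 0} := by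
    ext v
    exact and_congr_right fun hv => (wedge_eq_zero_iff (hv i) (hv j)).not.symm
  rw [h]
  exact (G (ι × Fin 2)).top.isOpen_inter _ _ (hG.isOpen_homogCoords ι)
    (hG.isOpen_ne_of_mem (hG.wedge_mem i j))

end SpaceWithFunctions.IsGeometry

namespace ModuliSpace

variable {n : ℕ} (K : LowerSet (Finset (Fin n)))

/-- Stability means that no non-face collapses to a point. In this form it is visibly open: a finite
intersection of unions of open sets. -/
theorem stable_eq : (Stable K : Set (Fin n → ProjLine)) =
    ⋂ I : {I : Finset (Fin n) // I ∉ K}, ⋃ i : I.1, ⋃ j : I.1, {p | p i ≠ p j} := by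
  ext p
  simp only [Set.mem_iInter, Set.mem_iUnion, SetLike.mem_coe]
  constructor
  · intro hp I
    by_contra! hI
    refine I.2 (hp I.1 fun i hi j hj => ?_)
    have := hI ⟨i, hi⟩ ⟨j, hj⟩
    simpa using this
  · intro hp I hI
    by_contra hIK
    obtain ⟨i, j, hij⟩ := hp ⟨I, hIK⟩
    exact hij (hI i.1 i.2 j.1 j.2)

variable {K} in
theorem mem_iff_compl_notMem (hASD : IsAlexanderSelfDual K) (A : Finset (Fin n)) :
    A ∈ K ↔ Aᶜ ∉ K := by
  conv_lhs => rw [← hASD]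
  rfl

variable {K} in
theorem empty_mem (hASD : IsAlexanderSelfDual K) : ∅ ∈ K := by
  rw [mem_iff_compl_notMem hASD]
  intro h
  exact (mem_iff_compl_notMem hASD _).1 h (K.lower (Finset.subset_univ _) (by simpa using h))

variable {K} in
-- Pairwise distinct points are stable, because only empty sets and singletons coincide. The point
-- obtained also supplies junk values, so that the later maps into the moduli space can be total.
theorem nonempty (hvertices : ∀ i : Fin n, {i} ∈ K) (hASD : IsAlexanderSelfDual K) :
    Nonempty (ModuliSpace K) := by
  let p : Fin n → ProjLine := fun i => Infinite.natEmbedding ProjLine i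
  have hp : Function.Injective p := fun i j h =>
    Fin.ext ((Infinite.natEmbedding ProjLine).injective h)
  refine ⟨mk K ⟨p, fun I hI => ?_⟩⟩
  rcases I.eq_empty_or_nonempty with rfl | ⟨i, hi⟩
  · exact empty_mem hASD
  · refine K.lower (fun j hj => ?_) (hvertices i)
    exact Finset.mem_singleton.2 (hp (hI j hj i hi))

variable [Nonempty (ModuliSpace K)]

/-- The class of a configuration, with a junk value at unstable ones. -/
def ofConfig (p : Fin n → ProjLine) : ModuliSpace K :=
  open Classical in if h : p ∈ Stable K then mk K ⟨p, h⟩ else Classical.arbitrary _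

/-- The class of the configuration with homogeneous coordinates `v`. -/
def ofVec (v : Fin n × Fin 2 → ℂ) : ModuliSpace K := ofConfig K (configOfVec v)

/-- The homogeneous coordinates of stable configurations. -/
def stableVec : Set (Fin n × Fin 2 → ℂ) :=
  homogCoords (Fin n) ∩ configOfVec ⁻¹' (Stable K : Set (Fin n → ProjLine))

variable {K}

theorem ofConfig_of_mem {p : Fin n → ProjLine} (hp : p ∈ Stable K) :
    ofConfig K p = mk K ⟨p, hp⟩ := dif_pos hp

theorem exists_ofConfig (x : ModuliSpace K) : ∃ p ∈ Stable K, ofConfig K p = x := by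
  obtain ⟨p, rfl⟩ := Quotient.exists_rep x
  exact ⟨p.1, p.2, ofConfig_of_mem p.2⟩

theorem exists_ofVec (x : ModuliSpace K) : ∃ v ∈ stableVec K, ofVec K v = x := by
  obtain ⟨p, hp, rfl⟩ := exists_ofConfig x
  refine ⟨vecOfConfig p, ⟨vecOfConfig_mem p, ?_⟩, ?_⟩
  · rwa [Set.mem_preimage, configOfVec_vecOfConfig]
  · rw [ofVec, configOfVec_vecOfConfig]

theorem ofConfig_eq_iff {p q : Fin n → ProjLine} (hp : p ∈ Stable K) (hq : q ∈ Stable K) :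
    ofConfig K p = ofConfig K q ↔ ∃ g : PSL(2, ℂ), g • q = p := by
  rw [ofConfig_of_mem hp, ofConfig_of_mem hq]
  refine Quotient.eq.trans ?_
  rw [MulAction.orbitRel_apply]
  exact ⟨fun ⟨g, hg⟩ => ⟨g, congrArg Subtype.val hg⟩, fun ⟨g, hg⟩ => ⟨g, Subtype.ext hg⟩⟩

/-- Two stable families of homogeneous coordinates represent the same point if and only if they
are related by an invertible matrix, up to scaling each vector. -/
theorem ofVec_eq_iff {v w : Fin n × Fin 2 → ℂ} (hv : v ∈ stableVec K) (hw : w ∈ stableVec K) :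
    ofVec K v = ofVec K w ↔ ∃ A : Matrix (Fin 2) (Fin 2) ℂ, A.det ≠ 0 ∧
      ∀ i, wedge (fun s => v (i, s)) (A.mulVec fun s => w (i, s)) = 0 := by
  rw [ofVec, ofVec, ofConfig_eq_iff hv.2 hw.2]
  constructor
  · rintro ⟨g, hg⟩
    obtain ⟨A, hA, h⟩ := exists_matrix g
    refine ⟨A, hA, fun i => (wedge_eq_zero_iff (hv.1 i) (mulVec_ne_zero hA (hw.1 i))).2 ?_⟩
    rw [← h _ (hw.1 i)]
    exact (congrFun hg i).symm
  · rintro ⟨A, hA, hvw⟩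
    obtain ⟨g, h⟩ := exists_psl hA
    refine ⟨g, funext fun i => ?_⟩
    have := (wedge_eq_zero_iff (hv.1 i) (mulVec_ne_zero hA (hw.1 i))).1 (hvw i)
    rw [← h _ (hw.1 i)] at this
    exact this.symm

end ModuliSpace

/-- The space `STABLE(K) / PSL(2, ℂ)` in the geometry `G`. -/
def moduli (G : (σ : Type) → [Fintype σ] → SpaceWithFunctions (σ → ℂ)) {n : ℕ}
    (K : LowerSet (Finset (Fin n))) : SpaceWithFunctions (ModuliSpace K) :=
  ((config G (Fin n)).comap (fun p : Stable K => p.1)).map (ModuliSpace.mk K)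

namespace SpaceWithFunctions.IsGeometry

variable {G : (σ : Type) → [Fintype σ] → SpaceWithFunctions (σ → ℂ)} (hG : IsGeometry G)
  {n : ℕ} (K : LowerSet (Finset (Fin n)))
include hG

theorem isOpen_stable : IsOpen[(config G (Fin n)).top] (Stable K : Set (Fin n → ProjLine)) := by
  rw [ModuliSpace.stable_eq]
  let _ := (config G (Fin n)).top
  exact isOpen_iInter_of_finite fun I => isOpen_iUnion fun i => isOpen_iUnion fun j =>
    hG.isOpen_config_ne i.1 j.1

theorem hasCoordinates_moduli : HasCoordinates G (moduli G K) :=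
  ((hG.hasCoordinates_config _).comap _).map _

variable [Nonempty (ModuliSpace K)]

theorem isQuotientOn_ofConfig : IsQuotientOn (config G (Fin n)) (moduli G K)
    (ModuliSpace.ofConfig K) (Stable K : Set (Fin n → ProjLine)) := by
  have hr : Set.range (fun p : Stable K => p.1) = (Stable K : Set (Fin n → ProjLine)) :=
    Subtype.range_coe
  have h := IsQuotientOn.of_comap_map (S := config G (Fin n)) (j := fun p : Stable K => p.1)
    (q := ModuliSpace.ofConfig K) (q' := ModuliSpace.mk K)
    (by rw [hr]; exact hG.isOpen_stable K)
    (by funext p; exact ModuliSpace.ofConfig_of_mem p.2)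
  rwa [hr] at h

/-- The torus and the group are divided out in one step, presenting the moduli space as a quotient
of an open subset of affine space. -/
theorem isQuotientOn_ofVec : IsQuotientOn (G (Fin n × Fin 2)) (moduli G K)
    (ModuliSpace.ofVec K) (ModuliSpace.stableVec K) :=
  (hG.isQuotientOn_ofConfig K).comp (hG.isQuotientOn_configOfVec (Fin n))

end SpaceWithFunctions.IsGeometry

end

/-! ### Normalizing three points: cross ratios and the charts they give. -/

noncomputable section

open SpaceWithFunctions ProjLine

namespace ProjLine

/-- The matrix sending the points `a`, `b`, `c` of the projective line to `0`, `1`, `∞`. -/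
def crossMatrix (a b c : Fin 2 → ℂ) : Matrix (Fin 2) (Fin 2) ℂ :=
  !![a 1 * wedge b c, -(a 0 * wedge b c); c 1 * wedge b a, -(c 0 * wedge b a)]

theorem crossMatrix_mulVec (a b c v : Fin 2 → ℂ) :
    (crossMatrix a b c).mulVec v = ![wedge v a * wedge b c, wedge v c * wedge b a] := by
  ext s
  fin_cases s <;> simp [crossMatrix, Matrix.mulVec, dotProduct, wedge] <;> ring

theorem det_crossMatrix (a b c : Fin 2 → ℂ) :
    (crossMatrix a b c).det = wedge b c * wedge b a * wedge a c := by
  simp only [crossMatrix, Matrix.det_fin_two_of, wedge]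
  ring

theorem wedge_swap (u v : Fin 2 → ℂ) : wedge u v = -wedge v u := by
  simp only [wedge]; ring

@[simp] theorem wedge_self (u : Fin 2 → ℂ) : wedge u u = 0 := by
  simp only [wedge]; ring

theorem wedge_mulVec (A : Matrix (Fin 2) (Fin 2) ℂ) (u v : Fin 2 → ℂ) :
    wedge (A.mulVec u) (A.mulVec v) = A.det * wedge u v := by
  simp [wedge, Matrix.mulVec, dotProduct, Matrix.det_fin_two]
  ring

theorem wedge_smul_smul (c d : ℂ) (u v : Fin 2 → ℂ) :
    wedge (c • u) (d • v) = c * d * wedge u v := by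
  simp only [wedge, Pi.smul_apply, smul_eq_mul]
  ring

/-- The position of `d` after normalizing `a`, `b`, `c` to `0`, `1`, `∞`. -/
def cross (a b c d : ProjLine) : ProjLine := ofVec ((crossMatrix a.rep b.rep c.rep).mulVec d.rep)

theorem det_crossMatrix_ne_zero {a b c : Fin 2 → ℂ} (ha : a ≠ 0) (hb : b ≠ 0) (hc : c ≠ 0)
    (hab : ofVec a ≠ ofVec b) (hbc : ofVec b ≠ ofVec c) (hac : ofVec a ≠ ofVec c) :
    (crossMatrix a b c).det ≠ 0 := by
  rw [det_crossMatrix]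
  exact mul_ne_zero (mul_ne_zero ((wedge_eq_zero_iff hb hc).not.2 hbc)
    ((wedge_eq_zero_iff hb ha).not.2 hab.symm)) ((wedge_eq_zero_iff ha hc).not.2 hac)

/-- The vector on the right is homogeneous of degree one in each of the four arguments, so other
representatives only rescale it. -/
theorem cross_ofVec {a b c d : Fin 2 → ℂ} (ha : a ≠ 0) (hb : b ≠ 0) (hc : c ≠ 0) (hd : d ≠ 0) :
    cross (ofVec a) (ofVec b) (ofVec c) (ofVec d) = ofVec ((crossMatrix a b c).mulVec d) := by
  obtain ⟨α, hα, h1⟩ := exists_smul_of_ofVec_eq (Projectivization.rep_nonzero _) ha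
    (ofVec_rep (ofVec a))
  obtain ⟨β, hβ, h2⟩ := exists_smul_of_ofVec_eq (Projectivization.rep_nonzero _) hb
    (ofVec_rep (ofVec b))
  obtain ⟨γ, hγ, h3⟩ := exists_smul_of_ofVec_eq (Projectivization.rep_nonzero _) hc
    (ofVec_rep (ofVec c))
  obtain ⟨δ, hδ, h4⟩ := exists_smul_of_ofVec_eq (Projectivization.rep_nonzero _) hd
    (ofVec_rep (ofVec d))
  rw [cross, h1, h2, h3, h4]
  have : (crossMatrix (α • a) (β • b) (γ • c)).mulVec (δ • d) =
      (α * β * γ * δ) • (crossMatrix a b c).mulVec d := by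
    rw [crossMatrix_mulVec, crossMatrix_mulVec]
    simp only [wedge_smul_smul]
    ext s
    fin_cases s <;> simp <;> ring
  rw [this, ofVec_smul (by simp [hα, hβ, hγ, hδ])]

/-- Both entries of the cross vector are products of two wedges, so a matrix `A` multiplies the
vector by the scalar `A.det ^ 2`. -/
theorem cross_smul (g : PSL(2, ℂ)) {a b c d : ProjLine} :
    cross (g • a) (g • b) (g • c) (g • d) = cross a b c d := by
  obtain ⟨A, hA, h⟩ := exists_matrix g
  have hr (p : ProjLine) : g • p = ofVec (A.mulVec p.rep) := by
    rw [← h _ p.rep_nonzero, ofVec_rep]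
  have hne (p : ProjLine) : A.mulVec p.rep ≠ 0 := mulVec_ne_zero hA p.rep_nonzero
  rw [hr, hr, hr, hr, cross_ofVec (hne a) (hne b) (hne c) (hne d), cross]
  have : (crossMatrix (A.mulVec a.rep) (A.mulVec b.rep) (A.mulVec c.rep)).mulVec
      (A.mulVec d.rep) = (A.det ^ 2) • (crossMatrix a.rep b.rep c.rep).mulVec d.rep := by
    rw [crossMatrix_mulVec, crossMatrix_mulVec]
    simp only [wedge_mulVec]
    ext s
    fin_cases s <;> simp <;> ring
  rw [this, ofVec_smul (pow_ne_zero 2 hA)]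

theorem exists_smul_eq_cross {a b c : ProjLine} (hab : a ≠ b) (hbc : b ≠ c) (hac : a ≠ c) :
    ∃ g : PSL(2, ℂ), ∀ d, g • d = cross a b c d := by
  obtain ⟨g, hg⟩ := exists_psl (det_crossMatrix_ne_zero a.rep_nonzero b.rep_nonzero c.rep_nonzero
    (by simpa using hab) (by simpa using hbc) (by simpa using hac))
  refine ⟨g, fun d => ?_⟩
  rw [cross, ← hg _ d.rep_nonzero, ofVec_rep]

theorem cross_zero_one_infty (d : ProjLine) : cross zero one infty d = d := by
  rw [← ofVec_zero_one, ← ofVec_one_one, ← ofVec_one_zero]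
  conv_lhs => rw [← ofVec_rep d]
  rw [cross_ofVec (by simp) (by simp) (by simp) d.rep_nonzero]
  -- For the chosen representatives of `0`, `1`, `∞` the cross matrix is minus the identity.
  conv_rhs => rw [← ofVec_rep d, ← ofVec_smul (c := -1) (by simp)]
  congr 1
  ext s
  fin_cases s <;> simp [crossMatrix, Matrix.mulVec, dotProduct, wedge]

theorem cross_left {a b c : ProjLine} (hab : a ≠ b) (hac : a ≠ c) : cross a b c a = zero := by
  have h1 : wedge a.rep c.rep ≠ 0 :=
    (wedge_eq_zero_iff a.rep_nonzero c.rep_nonzero).not.2 (by simpa using hac)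
  have h2 : wedge b.rep a.rep ≠ 0 :=
    (wedge_eq_zero_iff b.rep_nonzero a.rep_nonzero).not.2 (by simpa using hab.symm)
  rw [cross, crossMatrix_mulVec, ← ofVec_zero_one, ← ofVec_smul (mul_ne_zero h1 h2) ![0, 1]]
  simp

theorem cross_middle {a b c : ProjLine} (hab : a ≠ b) (hbc : b ≠ c) : cross a b c b = one := by
  have h1 : wedge b.rep c.rep ≠ 0 :=
    (wedge_eq_zero_iff b.rep_nonzero c.rep_nonzero).not.2 (by simpa using hbc)
  have h2 : wedge b.rep a.rep ≠ 0 :=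
    (wedge_eq_zero_iff b.rep_nonzero a.rep_nonzero).not.2 (by simpa using hab.symm)
  rw [cross, crossMatrix_mulVec, ← ofVec_one_one, ← ofVec_smul (mul_ne_zero h2 h1) ![1, 1]]
  simp [mul_comm]

theorem cross_right {a b c : ProjLine} (hbc : b ≠ c) (hac : a ≠ c) : cross a b c c = infty := by
  have h1 : wedge c.rep a.rep ≠ 0 :=
    (wedge_eq_zero_iff c.rep_nonzero a.rep_nonzero).not.2 (by simpa using hac.symm)
  have h2 : wedge b.rep c.rep ≠ 0 :=
    (wedge_eq_zero_iff b.rep_nonzero c.rep_nonzero).not.2 (by simpa using hbc)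
  rw [cross, crossMatrix_mulVec, ← ofVec_one_zero, ← ofVec_smul (mul_ne_zero h1 h2) ![1, 0]]
  simp

theorem zero_ne_one : zero ≠ one := by
  rw [← ofVec_zero_one, ← ofVec_one_one, ne_eq, ← wedge_eq_zero_iff (by simp) (by simp)]
  simp [wedge]

theorem one_ne_infty : one ≠ infty := by
  rw [← ofVec_one_zero, ← ofVec_one_one, ne_eq, ← wedge_eq_zero_iff (by simp) (by simp)]
  simp [wedge]

theorem zero_ne_infty : zero ≠ infty := by
  rw [← ofVec_one_zero, ← ofVec_zero_one, ne_eq, ← wedge_eq_zero_iff (by simp) (by simp)]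
  simp [wedge]

end ProjLine

/-- The indices of the points that are not normalized. -/
abbrev FreeIndex {n : ℕ} (i j k : Fin n) : Type := {l : Fin n // l ≠ i ∧ l ≠ j ∧ l ≠ k}

theorem card_freeIndex {n : ℕ} {i j k : Fin n} (hij : i ≠ j) (hjk : j ≠ k) (hik : i ≠ k) :
    Fintype.card (FreeIndex i j k) = n - 3 := by
  rw [Fintype.card_subtype]
  have : (Finset.univ.filter fun l : Fin n => l ≠ i ∧ l ≠ j ∧ l ≠ k) = {i, j, k}ᶜ := by
    ext l
    simp
  rw [this, Finset.card_compl, Fintype.card_fin, Finset.card_eq_three.2 ⟨i, j, k, hij, hik, hjk, rfl⟩]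

namespace ModuliSpace

variable {n : ℕ} {K : LowerSet (Finset (Fin n))} (i j k : Fin n)

/-- The configurations with `p_i`, `p_j`, `p_k` pairwise distinct. -/
def distinct : Set (Fin n → ProjLine) := {p | p i ≠ p j ∧ p j ≠ p k ∧ p i ≠ p k}

/-- The free points of a configuration after normalizing `p_i = 0`, `p_j = 1`, `p_k = ∞`. -/
def freePoints (p : Fin n → ProjLine) : FreeIndex i j k → ProjLine :=
  fun l => cross (p i) (p j) (p k) (p l.1)

/-- Homogeneous coordinates of the normalized configuration. -/
def normalizedVec (v : FreeIndex i j k × Fin 2 → ℂ) : Fin n × Fin 2 → ℂ :=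
  fun a =>
    if hi : a.1 = i then (![0, 1] : Fin 2 → ℂ) a.2
    else if hj : a.1 = j then (![1, 1] : Fin 2 → ℂ) a.2
    else if hk : a.1 = k then (![1, 0] : Fin 2 → ℂ) a.2
    else v (⟨a.1, hi, hj, hk⟩, a.2)

/-- Homogeneous coordinates of the free points of a configuration. -/
def freeVec (v : Fin n × Fin 2 → ℂ) : FreeIndex i j k × Fin 2 → ℂ :=
  fun a => (crossMatrix (fun s => v (i, s)) (fun s => v (j, s)) (fun s => v (k, s))).mulVec
    (fun s => v (a.1.1, s)) a.2

variable {i j k}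

theorem configOfVec_normalizedVec (v : FreeIndex i j k × Fin 2 → ℂ) :
    configOfVec (normalizedVec i j k v) = normalized i j k (configOfVec v) := by
  funext l
  simp only [configOfVec, normalizedVec, normalized]
  split_ifs
  · exact ofVec_zero_one
  · exact ofVec_one_one
  · exact ofVec_one_zero
  · rfl

theorem normalizedVec_mem {v : FreeIndex i j k × Fin 2 → ℂ} (hv : v ∈ homogCoords _) :
    normalizedVec i j k v ∈ homogCoords (Fin n) := by
  intro l
  simp only [normalizedVec]
  split_ifs with hi hj hk
  · exact fun h => by simpa using congrFun h 1
  · exact fun h => by simpa using congrFun h 1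
  · exact fun h => by simpa using congrFun h 0
  · exact hv ⟨l, hi, hj, hk⟩

theorem configOfVec_freeVec {v : Fin n × Fin 2 → ℂ} (hv : v ∈ homogCoords (Fin n)) :
    configOfVec (freeVec i j k v) = freePoints i j k (configOfVec v) := by
  funext l
  exact (cross_ofVec (hv i) (hv j) (hv k) (hv l.1)).symm

theorem freeVec_mem {v : Fin n × Fin 2 → ℂ} (hv : v ∈ homogCoords (Fin n))
    (hd : configOfVec v ∈ distinct i j k) : freeVec i j k v ∈ homogCoords (FreeIndex i j k) :=
  fun l => mulVec_ne_zero (det_crossMatrix_ne_zero (hv i) (hv j) (hv k) hd.1 hd.2.1 hd.2.2)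
    (hv l.1)

theorem normalized_mem_distinct (hij : i ≠ j) (hjk : j ≠ k) (hik : i ≠ k)
    (w : FreeIndex i j k → ProjLine) : normalized i j k w ∈ distinct i j k := by
  simp [distinct, normalized, hij.symm, hik.symm, hjk.symm, zero_ne_one, one_ne_infty,
    zero_ne_infty]

theorem freePoints_normalized (hij : i ≠ j) (hjk : j ≠ k) (hik : i ≠ k)
    (w : FreeIndex i j k → ProjLine) : freePoints i j k (normalized i j k w) = w := by
  funext l
  simp [freePoints, normalized, hij.symm, hik.symm, hjk.symm, cross_zero_one_infty, l.2.1,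
    l.2.2.1, l.2.2.2]

theorem normalized_freePoints {p : Fin n → ProjLine} (hp : p ∈ distinct i j k) (l : Fin n) :
    normalized i j k (freePoints i j k p) l = cross (p i) (p j) (p k) (p l) := by
  simp only [normalized, freePoints]
  split_ifs with hi hj hk
  · rw [hi, cross_left hp.1 hp.2.2]
  · rw [hj, cross_middle hp.1 hp.2.1]
  · rw [hk, cross_right hp.2.1 hp.2.2]
  · rfl

theorem freePoints_smul (g : PSL(2, ℂ)) (p : Fin n → ProjLine) :
    freePoints i j k (g • p) = freePoints i j k p :=
  funext fun _ => cross_smul g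

theorem smul_mem_distinct {g : PSL(2, ℂ)} {p : Fin n → ProjLine} (hp : p ∈ distinct i j k) :
    g • p ∈ distinct i j k :=
  ⟨(MulAction.injective g).ne hp.1, (MulAction.injective g).ne hp.2.1,
    (MulAction.injective g).ne hp.2.2⟩

theorem exists_smul_eq_normalized {p : Fin n → ProjLine} (hp : p ∈ distinct i j k) :
    ∃ g : PSL(2, ℂ), g • p = normalized i j k (freePoints i j k p) := by
  obtain ⟨g, hg⟩ := exists_smul_eq_cross hp.1 hp.2.1 hp.2.2
  exact ⟨g, funext fun l => (hg _).trans (normalized_freePoints hp l).symm⟩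

/-- Every stable configuration takes at least three values. -/
theorem exists_mem_distinct (hASD : IsAlexanderSelfDual K) {p : Fin n → ProjLine}
    (hp : p ∈ Stable K) : ∃ i j k, i ≠ j ∧ j ≠ k ∧ i ≠ k ∧ p ∈ distinct i j k := by
  classical
  by_contra! hcon
  -- No three values are distinct, so two points that both differ from a third one are equal.
  have hcon' (i j k : Fin n) (h1 : p i ≠ p j) (h2 : p j ≠ p k) : p i = p k := by
    by_contra h3
    exact hcon i j k (fun h => h1 (congrArg p h)) (fun h => h2 (congrArg p h))
      (fun h => h3 (congrArg p h)) ⟨h1, h2, h3⟩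
  have hall (a : ProjLine) : Finset.univ.filter (fun l => p l = a) ∈ K :=
    hp _ fun i hi j hj => by simp_all
  rcases isEmpty_or_nonempty (Fin n) with h | ⟨⟨i⟩⟩
  -- For `n = 0` the empty set is its own complement, which self-duality forbids.
  · have h1 := hall zero
    refine (mem_iff_compl_notMem hASD _).1 h1 ?_
    rwa [Subsingleton.elim (Finset.univ.filter (fun l => p l = zero))ᶜ]
  -- The points off the fibre of `p i` all coincide, so this fibre and its complement are both
  -- faces.
  · refine (mem_iff_compl_notMem hASD _).1 (hall (p i)) (hp _ fun a ha b hb => ?_)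
    simp only [Finset.compl_filter, Finset.mem_filter, Finset.mem_univ, true_and] at ha hb
    exact hcon' a i b ha (Ne.symm hb)

variable [Nonempty (ModuliSpace K)]

variable (K i j k) in
/-- The free points of a representative. -/
def coordinates (x : ModuliSpace K) : FreeIndex i j k → ProjLine :=
  freePoints i j k (exists_ofConfig x).choose

theorem coordinates_ofConfig {p : Fin n → ProjLine} (hp : p ∈ Stable K) :
    coordinates K i j k (ofConfig K p) = freePoints i j k p := by
  obtain ⟨hq, h⟩ := (exists_ofConfig (ofConfig K p)).choose_spec
  obtain ⟨g, hg⟩ := (ofConfig_eq_iff hq hp).1 h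
  rw [coordinates, ← hg, freePoints_smul]

theorem ofConfig_mem_distinctLocus {p : Fin n → ProjLine} (hp : p ∈ Stable K) :
    ofConfig K p ∈ distinctLocus K i j k ↔ p ∈ distinct i j k := by
  constructor
  · rintro ⟨q, hq, hd⟩
    rw [← ofConfig_of_mem q.2, eq_comm, ofConfig_eq_iff hp q.2] at hq
    obtain ⟨g, rfl⟩ := hq
    exact smul_mem_distinct hd
  · exact fun h => ⟨⟨p, hp⟩, (ofConfig_of_mem hp).symm, h⟩

theorem image_normalizedSet (hij : i ≠ j) (hjk : j ≠ k) (hik : i ≠ k) :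
    (ofConfig K ∘ normalized i j k) '' normalizedSet K i j k = distinctLocus K i j k := by
  ext x
  constructor
  · rintro ⟨w, hw, rfl⟩
    exact (ofConfig_mem_distinctLocus hw).2 (normalized_mem_distinct hij hjk hik w)
  · intro hx
    obtain ⟨p, hp, rfl⟩ := exists_ofConfig x
    rw [ofConfig_mem_distinctLocus hp] at hx
    obtain ⟨g, hg⟩ := exists_smul_eq_normalized hx
    have hs : normalized i j k (freePoints i j k p) ∈ Stable K := hg ▸ (Stable K).smul_mem g hp
    exact ⟨freePoints i j k p, hs, (ofConfig_eq_iff hs hp).2 ⟨g, hg⟩⟩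

theorem exists_mem_distinctLocus (hASD : IsAlexanderSelfDual K) (x : ModuliSpace K) :
    ∃ i j k : Fin n, i ≠ j ∧ j ≠ k ∧ i ≠ k ∧ x ∈ distinctLocus K i j k := by
  obtain ⟨p, hp, rfl⟩ := exists_ofConfig x
  obtain ⟨i, j, k, h1, h2, h3, h⟩ := exists_mem_distinct hASD hp
  exact ⟨i, j, k, h1, h2, h3, (ofConfig_mem_distinctLocus hp).2 h⟩

end ModuliSpace

open ModuliSpace

namespace SpaceWithFunctions.IsGeometry

variable {G : (σ : Type) → [Fintype σ] → SpaceWithFunctions (σ → ℂ)} (hG : IsGeometry G)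
  {n : ℕ} (K : LowerSet (Finset (Fin n))) {i j k : Fin n}
include hG

theorem isMorphismOn_normalizedVec :
    IsMorphismOn (G (FreeIndex i j k × Fin 2)) (G (Fin n × Fin 2)) (normalizedVec i j k)
      Set.univ := by
  refine hG.isMorphismOn fun a => ?_
  simp only [normalizedVec]
  split_ifs
  · exact Subalgebra.algebraMap_mem _ _
  · exact Subalgebra.algebraMap_mem _ _
  · exact Subalgebra.algebraMap_mem _ _
  · exact hG.coord_mem _ _

theorem isMorphismOn_freeVec :
    IsMorphismOn (G (Fin n × Fin 2)) (G (FreeIndex i j k × Fin 2)) (freeVec i j k) Set.univ := by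
  refine hG.isMorphismOn fun ⟨l, s⟩ => ?_
  simp only [freeVec, crossMatrix_mulVec]
  fin_cases s
  · exact mul_mem (hG.wedge_mem l.1 i) (hG.wedge_mem j k)
  · exact mul_mem (hG.wedge_mem l.1 k) (hG.wedge_mem j i)

theorem isMorphismOn_normalized :
    IsMorphismOn (config G (FreeIndex i j k)) (config G (Fin n)) (normalized i j k) Set.univ := by
  refine (hG.isQuotientOn_configOfVec _).descend ?_
  have h := (hG.isQuotientOn_configOfVec (Fin n)).toIsMorphismOn.comp
    (hG.isMorphismOn_normalizedVec (i := i) (j := j) (k := k))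
  rw [Set.preimage_univ, Set.inter_univ]
  refine (h.mono (hG.isOpen_homogCoords _) fun v hv => ⟨trivial, normalizedVec_mem hv⟩).congr ?_
  exact fun v _ => configOfVec_normalizedVec v

theorem isOpen_distinct : IsOpen[(config G (Fin n)).top] (distinct i j k) := by
  let _ := (config G (Fin n)).top
  exact (hG.isOpen_config_ne i j).inter ((hG.isOpen_config_ne j k).inter (hG.isOpen_config_ne i k))

theorem isMorphismOn_freePoints :
    IsMorphismOn (config G (Fin n)) (config G (FreeIndex i j k)) (freePoints i j k)
      (distinct i j k) := by
  refine (hG.isQuotientOn_configOfVec _).descend ?_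
  have h := (hG.isQuotientOn_configOfVec (FreeIndex i j k)).toIsMorphismOn.comp hG.isMorphismOn_freeVec
  refine (h.mono ((hG.isQuotientOn_configOfVec _).isOpen_inter_preimage _ hG.isOpen_distinct)
    fun v hv => ⟨trivial, freeVec_mem hv.1 hv.2⟩).congr ?_
  exact fun v hv => configOfVec_freeVec hv.1

theorem isOpen_normalizedSet :
    IsOpen[(config G (FreeIndex i j k)).top] (normalizedSet K i j k) := by
  have := (hG.isMorphismOn_normalized (i := i) (j := j) (k := k)).isOpen_inter_preimage _
    (hG.isOpen_stable K)
  rwa [Set.univ_inter] at this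

variable [Nonempty (ModuliSpace K)]

/-- The normalized configurations are a slice for the action. Cross ratios are constant on orbits
and polynomial in homogeneous coordinates, so they descend to a regular inverse. -/
theorem isLocalChart_normalized (hij : i ≠ j) (hjk : j ≠ k) (hik : i ≠ k) :
    IsLocalChart (config G (FreeIndex i j k)) (moduli G K) (normalizedSet K i j k)
      (ofConfig K ∘ normalized i j k) (coordinates K i j k) where
  morphism := ((hG.isQuotientOn_ofConfig K).toIsMorphismOn.comp hG.isMorphismOn_normalized).mono
    (hG.isOpen_normalizedSet K) fun _ hw => ⟨trivial, hw⟩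
  inverse := by
    rw [image_normalizedSet hij hjk hik]
    refine (hG.isQuotientOn_ofConfig K).descend ?_
    have : (Stable K : Set (Fin n → ProjLine)) ∩ ofConfig K ⁻¹' distinctLocus K i j k =
        (Stable K : Set (Fin n → ProjLine)) ∩ distinct i j k := by
      ext p
      exact and_congr_right fun hp => ofConfig_mem_distinctLocus hp
    rw [this]
    refine (hG.isMorphismOn_freePoints.mono ((config G (Fin n)).top.isOpen_inter _ _
      (hG.isOpen_stable K) hG.isOpen_distinct) Set.inter_subset_right).congr ?_
    exact fun p hp => (coordinates_ofConfig hp.1).symm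
  left_inv w hw := by
    rw [Function.comp_apply, coordinates_ofConfig hw, freePoints_normalized hij hjk hik]

end SpaceWithFunctions.IsGeometry

/-! ### Standard affine charts of a power of the projective line, and charts of the moduli space in
`ℂ^σ`. -/

section AffineCharts

variable {σ ι : Type}

/-- Homogeneous coordinates of the points of `(ℂP¹)^ι` whose coordinate of index `t l` is `1`. -/
def affineVec (e : σ ≃ ι) (t : ι → Fin 2) (z : σ → ℂ) : ι × Fin 2 → ℂ :=
  fun a => if a.2 = t a.1 then 1 else z (e.symm a.1)

/-- The inverse of the standard affine charts of `(ℂP¹)^ι`. -/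
def affineCoordinates (e : σ ≃ ι) (t : ι → Fin 2) (p : ι → ProjLine) : σ → ℂ :=
  fun a => (p (e a)).rep (t (e a) + 1) / (p (e a)).rep (t (e a))

variable (e : σ ≃ ι) (t : ι → Fin 2)

theorem affineVec_mem (z : σ → ℂ) : affineVec e t z ∈ homogCoords ι := by
  intro l h
  simpa [affineVec] using congrFun h (t l)

/-- In `Fin 2` the index `t + 1` is the one other than `t`. The ratio of the two coordinates does
not depend on the representative. -/
theorem affineCoordinates_configOfVec {v : ι × Fin 2 → ℂ} (hv : v ∈ homogCoords ι) (a : σ) :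
    affineCoordinates e t (configOfVec v) a = v (e a, t (e a) + 1) / v (e a, t (e a)) := by
  obtain ⟨c, hc, h⟩ := exists_smul_of_ofVec_eq (Projectivization.rep_nonzero _) (hv (e a))
    (ofVec_rep (ofVec fun s => v (e a, s)))
  simp only [affineCoordinates, configOfVec, h, Pi.smul_apply, smul_eq_mul]
  exact mul_div_mul_left _ _ hc

theorem affineCoordinates_affineVec (z : σ → ℂ) :
    affineCoordinates e t (configOfVec (affineVec e t z)) = z := by
  funext a
  rw [affineCoordinates_configOfVec _ _ (affineVec_mem e t z)]
  simp [affineVec]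

theorem configOfVec_affineVec {v : ι × Fin 2 → ℂ} (ht : ∀ l, v (l, t l) ≠ 0) :
    configOfVec (affineVec e t fun a => v (e a, t (e a) + 1) / v (e a, t (e a))) =
      configOfVec v := by
  funext l
  have h : (fun s => affineVec e t (fun a => v (e a, t (e a) + 1) / v (e a, t (e a))) (l, s)) =
      (v (l, t l))⁻¹ • fun s => v (l, s) := by
    funext s
    simp only [affineVec, Equiv.apply_symm_apply, Pi.smul_apply, smul_eq_mul]
    split_ifs with hs
    · rw [hs, inv_mul_cancel₀ (ht l)]
    · have : s = t l + 1 := by omega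
      rw [this, div_eq_inv_mul]
  rw [configOfVec, h, ofVec_smul (inv_ne_zero (ht l))]
  rfl

theorem configOfVec_mem_range_affineVec {v : ι × Fin 2 → ℂ} (hv : v ∈ homogCoords ι) :
    configOfVec v ∈ (configOfVec ∘ affineVec e t) '' Set.univ ↔ ∀ l, v (l, t l) ≠ 0 := by
  constructor
  · rintro ⟨z, -, hz⟩ l
    obtain ⟨c, hc, h⟩ := exists_smul_of_ofVec_eq (hv l) (affineVec_mem e t z l)
      (congrFun hz l).symm
    have := congrFun h (t l)
    simp only [affineVec, Pi.smul_apply, if_true, smul_eq_mul, mul_one] at this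
    rwa [this]
  · exact fun ht => ⟨_, trivial, configOfVec_affineVec e t ht⟩

theorem SpaceWithFunctions.IsGeometry.isMorphismOn_affineVec [Fintype σ] [Fintype ι]
    {G : (σ : Type) → [Fintype σ] → SpaceWithFunctions (σ → ℂ)} (hG : IsGeometry G) :
    IsMorphismOn (G σ) (G (ι × Fin 2)) (affineVec e t) Set.univ := by
  refine hG.isMorphismOn fun a => ?_
  simp only [affineVec]
  split_ifs
  · exact Subalgebra.algebraMap_mem _ _
  · exact hG.coord_mem _ _

theorem SpaceWithFunctions.IsGeometry.isLocalChart_affine [Fintype σ] [Fintype ι]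
    {G : (σ : Type) → [Fintype σ] → SpaceWithFunctions (σ → ℂ)} (hG : IsGeometry G) :
    IsLocalChart (G σ) (config G ι) Set.univ (configOfVec ∘ affineVec e t)
      (affineCoordinates e t) where
  morphism := by
    refine ((hG.isQuotientOn_configOfVec ι).toIsMorphismOn.comp (hG.isMorphismOn_affineVec e t)).mono
      (@isOpen_univ _ (G σ).top) fun z _ => ⟨trivial, affineVec_mem e t z⟩
  inverse := by
    refine (hG.isQuotientOn_configOfVec ι).descend ?_
    have h : homogCoords ι ∩ configOfVec ⁻¹' ((configOfVec ∘ affineVec e t) '' Set.univ) =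
        homogCoords ι ∩ ⋂ l, {v | v (l, t l) ≠ 0} := by
      ext v
      refine and_congr_right fun hv => ?_
      rw [Set.mem_preimage, configOfVec_mem_range_affineVec e t hv]
      simp
    have hO : IsOpen[(G (ι × Fin 2)).top] (homogCoords ι ∩ ⋂ l, {v | v (l, t l) ≠ 0}) := by
      let _ := (G (ι × Fin 2)).top
      exact (hG.isOpen_homogCoords ι).inter
        (isOpen_iInter_of_finite fun l => hG.isOpen_ne_of_mem (hG.coord_mem _ (l, t l)))
    rw [h]
    refine (hG.hasCoordinates _ σ _ hO
      (fun v a => v (e a, t (e a) + 1) / v (e a, t (e a))) fun a => ?_).congr ?_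
    · simp only [div_eq_mul_inv]
      refine mul_mem (hG.coord_mem' _ _) (SpaceWithFunctions.restrict _ ?_
        (hG.inv_comp_mem (hG.hasCoordinates _) (@isOpen_univ _ (G (ι × Fin 2)).top)
          (hG.coord_mem _ (e a, t (e a)))))
      exact fun v hv => ⟨trivial, Set.mem_iInter.1 hv.2 (e a)⟩
    · intro v hv
      funext a
      exact (affineCoordinates_configOfVec e t hv.1 a).symm
  left_inv z _ := affineCoordinates_affineVec e t z

theorem exists_mem_range_affineVec (p : ι → ProjLine) :
    ∃ t, p ∈ (configOfVec ∘ affineVec e t) '' Set.univ := by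
  have h (l : ι) : ∃ s, (p l).rep s ≠ 0 := Function.ne_iff.1 (p l).rep_nonzero
  choose t ht using h
  refine ⟨t, ?_⟩
  have := (configOfVec_mem_range_affineVec e t (vecOfConfig_mem p)).2 ht
  rwa [configOfVec_vecOfConfig] at this

end AffineCharts

/-- Around every point of the moduli space there is a chart with values in `ℂ^σ`, which lifts to
homogeneous coordinates, and which is the same in all geometries. -/
theorem ModuliSpace.exists_isLocalChart {n : ℕ} {K : LowerSet (Finset (Fin n))}
    (hASD : IsAlexanderSelfDual K) [Nonempty (ModuliSpace K)] {σ : Type} [Fintype σ]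
    (hσ : Fintype.card σ = n - 3) (x : ModuliSpace K) :
    ∃ (V : Set (σ → ℂ)) (L : (σ → ℂ) → Fin n × Fin 2 → ℂ) (ρ : ModuliSpace K → σ → ℂ),
      (∀ z ∈ V, L z ∈ stableVec K) ∧ x ∈ (ofVec K ∘ L) '' V ∧
      ∀ G : (σ : Type) → [Fintype σ] → SpaceWithFunctions (σ → ℂ), IsGeometry G →
        IsMorphismOn (G σ) (G (Fin n × Fin 2)) L Set.univ ∧
        IsLocalChart (G σ) (moduli G K) V (ofVec K ∘ L) ρ := by
  obtain ⟨i, j, k, hij, hjk, hik, hx⟩ := exists_mem_distinctLocus hASD x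
  rw [← image_normalizedSet hij hjk hik] at hx
  obtain ⟨w, hw, rfl⟩ := hx
  have e : σ ≃ FreeIndex i j k :=
    Fintype.equivOfCardEq (hσ.trans (card_freeIndex hij hjk hik).symm)
  obtain ⟨t, z, -, rfl⟩ := exists_mem_range_affineVec e w
  have hL : ofVec K ∘ normalizedVec i j k ∘ affineVec e t =
      (ofConfig K ∘ normalized i j k) ∘ configOfVec ∘ affineVec e t := by
    funext z
    simp [ofVec, configOfVec_normalizedVec]
  refine ⟨Set.univ ∩ (configOfVec ∘ affineVec e t) ⁻¹' normalizedSet K i j k,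
    normalizedVec i j k ∘ affineVec e t, affineCoordinates e t ∘ coordinates K i j k, ?_, ?_, ?_⟩
  · intro z hz
    refine ⟨normalizedVec_mem (affineVec_mem e t z), ?_⟩
    rw [Set.mem_preimage, Function.comp_apply, configOfVec_normalizedVec]
    exact hz.2
  · rw [hL]
    exact ⟨z, ⟨trivial, hw⟩, rfl⟩
  · intro G hG
    refine ⟨by simpa using hG.isMorphismOn_normalizedVec.comp (hG.isMorphismOn_affineVec e t), ?_⟩
    rw [hL]
    exact (hG.isLocalChart_normalized K hij hjk hik).comp (hG.isLocalChart_affine e t)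

end

/-! ### Separatedness: the orbit relation is given by minors. -/

noncomputable section

open SpaceWithFunctions ProjLine

namespace ProjLine

/-- The coefficients of the bilinear form `(u, v) ↦ wedge u (A v)`. -/
def wedgeCoeff (A : Matrix (Fin 2) (Fin 2) ℂ) : Fin 2 × Fin 2 → ℂ :=
  fun a => if a.1 = 0 then A 1 a.2 else -A 0 a.2

theorem sum_wedgeCoeff (A : Matrix (Fin 2) (Fin 2) ℂ) (u v : Fin 2 → ℂ) :
    ∑ a : Fin 2 × Fin 2, u a.1 * v a.2 * wedgeCoeff A a = wedge u (A.mulVec v) := by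
  simp [Fintype.sum_prod_type, wedgeCoeff, wedge, Matrix.mulVec, dotProduct]
  ring

theorem exists_wedgeCoeff_eq (c : Fin 2 × Fin 2 → ℂ) : ∃ A, wedgeCoeff A = c := by
  refine ⟨!![-c (1, 0), -c (1, 1); c (0, 0), c (0, 1)], ?_⟩
  ext ⟨a, b⟩
  fin_cases a <;> fin_cases b <;> simp [wedgeCoeff]

end ProjLine

/-- A spanning family contains a basis; the vectors of this basis are the rows of an invertible
square matrix. -/
theorem exists_det_ne_zero_of_span_eq_top {𝕜 ι κ : Type*} [Field 𝕜] [Fintype κ] [DecidableEq κ]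
    (r : ι → κ → 𝕜) (h : Submodule.span 𝕜 (Set.range r) = ⊤) :
    ∃ idx : κ → ι, (Matrix.of fun a => r (idx a)).det ≠ 0 := by
  obtain ⟨μ, a, -, hspan, hli⟩ := exists_linearIndependent' 𝕜 r
  let B := Module.Basis.mk hli (by rw [hspan, h])
  have : Fintype μ := FiniteDimensional.fintypeBasisIndex B
  have hcard : Fintype.card κ = Fintype.card μ := by
    rw [← Module.finrank_eq_card_basis B, Module.finrank_fintype_fun_eq_card]
  let e := Fintype.equivOfCardEq hcard
  refine ⟨a ∘ e, ?_⟩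
  rw [← isUnit_iff_ne_zero, ← Matrix.isUnit_iff_isUnit_det,
    ← Matrix.linearIndependent_rows_iff_isUnit]
  exact hli.comp e e.injective

namespace ModuliSpace

variable {n : ℕ} {K : LowerSet (Finset (Fin n))}

/-- The matrix with the rows `v_i ⊗ w_i` for the four indices `i` in the family `idx`. -/
def tensorMatrix (idx : Fin 2 × Fin 2 → Fin n) (v w : Fin n × Fin 2 → ℂ) :
    Matrix (Fin 2 × Fin 2) (Fin 2 × Fin 2) ℂ :=
  Matrix.of fun a b => v (idx a, b.1) * w (idx a, b.2)

/-- The Leibniz expansion separates `v` from `w`, giving the form `∑ f_a g_a` that `IsSeparated`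
asks for. -/
theorem det_tensorMatrix (idx : Fin 2 × Fin 2 → Fin n) (v w : Fin n × Fin 2 → ℂ) :
    (tensorMatrix idx v w).det = ∑ τ : Equiv.Perm (Fin 2 × Fin 2),
      (((Equiv.Perm.sign τ : ℤ) : ℂ) * ∏ a, v (idx (τ a), a.1)) * ∏ a, w (idx (τ a), a.2) := by
  rw [Matrix.det_apply']
  refine Finset.sum_congr rfl fun τ _ => ?_
  simp only [tensorMatrix, Matrix.of_apply, Finset.prod_mul_distrib, mul_assoc]

theorem mem_of_wedge_eq_zero {v : Fin n × Fin 2 → ℂ} (hv : v ∈ stableVec K) {I : Finset (Fin n)}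
    (hI : ∀ i ∈ I, ∀ j ∈ I, wedge (fun s => v (i, s)) (fun s => v (j, s)) = 0) : I ∈ K :=
  hv.2 I fun i hi j hj => (wedge_eq_zero_iff (hv.1 i) (hv.1 j)).1 (hI i hi j hj)

theorem wedge_eq_zero_trans {u v w : Fin 2 → ℂ} (hv : v ≠ 0) (h1 : wedge u v = 0)
    (h2 : wedge w v = 0) : wedge u w = 0 := by
  by_cases hu : u = 0
  · simp [hu, wedge]
  by_cases hw : w = 0
  · simp [hw, wedge]
  rw [wedge_eq_zero_iff hu hw, (wedge_eq_zero_iff hu hv).1 h1, (wedge_eq_zero_iff hw hv).1 h2]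

/-- A non-zero matrix relating two stable configurations is invertible. -/
theorem det_ne_zero_of_wedge_eq_zero (hASD : IsAlexanderSelfDual K) {v w : Fin n × Fin 2 → ℂ}
    (hv : v ∈ stableVec K) (hw : w ∈ stableVec K) {A : Matrix (Fin 2) (Fin 2) ℂ} (hA : A ≠ 0)
    (h : ∀ i, wedge (fun s => v (i, s)) (A.mulVec fun s => w (i, s)) = 0) : A.det ≠ 0 := by
  classical
  intro hdet
  set I : Finset (Fin n) := Finset.univ.filter fun i => A.mulVec (fun s => w (i, s)) ≠ 0 with hI
  -- As `A` is singular, the nonzero vectors `A w_i` are parallel, and so are the `v_i` that are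
  -- parallel to them.
  have h1 : I ∈ K := by
    refine mem_of_wedge_eq_zero hv fun i hi j hj => ?_
    have hi' := (Finset.mem_filter.1 hi).2
    have hj' := (Finset.mem_filter.1 hj).2
    have hij : wedge (A.mulVec fun s => w (j, s)) (A.mulVec fun s => w (i, s)) = 0 := by
      rw [wedge_mulVec, hdet, zero_mul]
    refine wedge_eq_zero_trans hi' (h i) ?_
    refine wedge_eq_zero_trans hj' (h j) ?_
    rw [wedge_swap, hij, neg_zero]
  -- Off `I` the vector `w_i` is killed by a nonzero row `r` of `A`, hence parallel to the vector
  -- spanning the kernel of that row.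
  have h2 : Iᶜ ∈ K := by
    obtain ⟨r, hr⟩ : ∃ r, A r ≠ 0 := by
      by_contra! hcon
      exact hA (funext hcon)
    have hb : ![-A r 1, A r 0] ≠ 0 := by
      intro h0
      apply hr
      ext s
      fin_cases s
      · simpa using congrFun h0 1
      · simpa using congrFun h0 0
    have key : ∀ i ∈ Iᶜ, wedge (fun s => w (i, s)) ![-A r 1, A r 0] = 0 := by
      intro i hi
      have h0 : A.mulVec (fun s => w (i, s)) = 0 := by simpa [hI] using hi
      have := congrFun h0 r
      simp only [Matrix.mulVec, dotProduct, Fin.sum_univ_two, Pi.zero_apply] at this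
      simp only [wedge, Matrix.cons_val_zero, Matrix.cons_val_one]
      linear_combination this
    exact mem_of_wedge_eq_zero hw fun i hi j hj => wedge_eq_zero_trans hb (key i hi) (key j hj)
  exact (mem_iff_compl_notMem hASD I).1 h1 h2

variable [Nonempty (ModuliSpace K)]

/-- A matrix `A` relating `v` to `w` provides a nonzero kernel vector, namely its coefficients
`wedgeCoeff A`. -/
theorem det_tensorMatrix_eq_zero {v w : Fin n × Fin 2 → ℂ} (hv : v ∈ stableVec K)
    (hw : w ∈ stableVec K) (h : ofVec K v = ofVec K w) (idx : Fin 2 × Fin 2 → Fin n) :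
    (tensorMatrix idx v w).det = 0 := by
  obtain ⟨A, hA, hvw⟩ := (ofVec_eq_iff hv hw).1 h
  refine Matrix.exists_mulVec_eq_zero_iff.1 ⟨wedgeCoeff A, ?_, ?_⟩
  · intro h0
    apply hA
    have h1 (s : Fin 2) : A 1 s = 0 := by simpa [wedgeCoeff] using congrFun h0 (0, s)
    simp [Matrix.det_fin_two, h1]
  · funext a
    simp only [Matrix.mulVec, dotProduct, tensorMatrix, Matrix.of_apply, Pi.zero_apply]
    rw [← hvw (idx a), ← sum_wedgeCoeff]

/-- If the rows `v_i ⊗ w_i` did not span, a nonzero functional would kill them all. Such a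
functional is the bilinear form of some `A ≠ 0`, which is invertible by self-duality and would put
`v` and `w` in one orbit. -/
theorem exists_det_tensorMatrix_ne_zero (hASD : IsAlexanderSelfDual K) {v w : Fin n × Fin 2 → ℂ}
    (hv : v ∈ stableVec K) (hw : w ∈ stableVec K) (h : ofVec K v ≠ ofVec K w) :
    ∃ idx, (tensorMatrix idx v w).det ≠ 0 := by
  refine exists_det_ne_zero_of_span_eq_top
    (fun (i : Fin n) (b : Fin 2 × Fin 2) => v (i, b.1) * w (i, b.2)) ?_
  by_contra hspan
  obtain ⟨f, hf, hle⟩ := Submodule.exists_le_ker_of_lt_top _ (lt_top_iff_ne_top.2 hspan)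
  obtain ⟨A, hA⟩ := exists_wedgeCoeff_eq fun b => f (Pi.single b 1)
  have hfA (r : Fin 2 × Fin 2 → ℂ) : f r = ∑ b, r b * wedgeCoeff A b := by
    conv_lhs => rw [← Finset.univ_sum_single r, map_sum]
    refine Finset.sum_congr rfl fun b _ => ?_
    rw [hA, ← smul_eq_mul, ← map_smul, ← Pi.single_smul, smul_eq_mul, mul_one]
  have hA0 : A ≠ 0 := by
    rintro rfl
    refine hf (LinearMap.ext fun r => ?_)
    simp [hfA, wedgeCoeff]
  have hvw (i : Fin n) : wedge (fun s => v (i, s)) (A.mulVec fun s => w (i, s)) = 0 := by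
    rw [← sum_wedgeCoeff, ← hfA fun b => v (i, b.1) * w (i, b.2)]
    exact hle (Submodule.subset_span ⟨i, rfl⟩)
  exact h ((ofVec_eq_iff hv hw).2 ⟨A, det_ne_zero_of_wedge_eq_zero hASD hv hw hA0 hvw, hvw⟩)

theorem isSeparated_moduli (hASD : IsAlexanderSelfDual K)
    {G : (σ : Type) → [Fintype σ] → SpaceWithFunctions (σ → ℂ)} (hG : IsGeometry G) :
    (moduli G K).IsSeparated := by
  -- The lift `L ∘ ρ` of a chart is a local section: homogeneous coordinates of a stable
  -- representative that are regular functions of the class.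
  have local_coords (x : ModuliSpace K) : ∃ (U : Set (ModuliSpace K))
      (f : ModuliSpace K → Fin n × Fin 2 → ℂ), IsOpen[(moduli G K).top] U ∧ x ∈ U ∧
      (∀ a, (fun z => f z a) ∈ (moduli G K).regular U) ∧
      ∀ z ∈ U, f z ∈ stableVec K ∧ ofVec K (f z) = z := by
    obtain ⟨V, L, ρ, hL, hx, h⟩ := exists_isLocalChart hASD (Fintype.card_fin (n - 3)) x
    obtain ⟨hLm, hc⟩ := h G hG
    have hm : IsMorphismOn (moduli G K) (G (Fin n × Fin 2)) (L ∘ ρ) ((ofVec K ∘ L) '' V) := by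
      simpa using hLm.comp hc.inverse
    refine ⟨_, L ∘ ρ, hc.inverse.isOpen, hx, hG.coord_comp_mem hm, ?_⟩
    rintro _ ⟨z, hz, rfl⟩
    rw [Function.comp_apply, hc.left_inv z hz]
    exact ⟨hL z hz, rfl⟩
  intro x y hxy
  obtain ⟨U, f, hU, hxU, hf, hfU⟩ := local_coords x
  obtain ⟨U', g, hU', hyU', hg, hgU'⟩ := local_coords y
  obtain ⟨idx, hidx⟩ := exists_det_tensorMatrix_ne_zero hASD (hfU x hxU).1 (hgU' y hyU').1
    (by rwa [(hfU x hxU).2, (hgU' y hyU').2])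
  let e := Fintype.equivFin (Equiv.Perm (Fin 2 × Fin 2))
  let P (m : Fin (Fintype.card (Equiv.Perm (Fin 2 × Fin 2)))) (z : ModuliSpace K) : ℂ :=
    ((Equiv.Perm.sign (e.symm m) : ℤ) : ℂ) * ∏ a : Fin 2 × Fin 2, f z (idx (e.symm m a), a.1)
  let Q (m : Fin (Fintype.card (Equiv.Perm (Fin 2 × Fin 2)))) (z : ModuliSpace K) : ℂ :=
    ∏ a : Fin 2 × Fin 2, g z (idx (e.symm m a), a.2)
  have hsum (u z : ModuliSpace K) : ∑ m, P m u * Q m z = (tensorMatrix idx (f u) (g z)).det := by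
    rw [det_tensorMatrix]
    exact Fintype.sum_equiv e.symm _ _ fun _ => rfl
  refine ⟨U, U', hU, hU', hxU, hyU', _, P, Q, fun m => ?_, fun m => ?_, ?_, fun z hz => ?_⟩
  rotate_left 2
  · rw [hsum]
    exact hidx
  · rw [hsum]
    exact det_tensorMatrix_eq_zero (hfU z hz.1).1 (hgU' z hz.2).1
      ((hfU z hz.1).2.trans (hgU' z hz.2).2.symm) idx
  · have := mul_mem (Subalgebra.algebraMap_mem ((moduli G K).regular U)
      ((Equiv.Perm.sign (e.symm m) : ℤ) : ℂ)) (prod_mem (t := Finset.univ)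
        fun (a : Fin 2 × Fin 2) _ => hf (idx (e.symm m a), a.1))
    convert this using 1
    ext z
    simp [P, Finset.prod_apply]
  · have := prod_mem (t := Finset.univ) fun (a : Fin 2 × Fin 2) _ => hg (idx (e.symm m a), a.2)
    convert this using 1
    ext z
    simp [Q, Finset.prod_apply]

end ModuliSpace

end

/-! ### Compactness: rescaling collapsed clusters. -/

noncomputable section

open SpaceWithFunctions ProjLine Filter

namespace ModuliSpace

variable {n : ℕ} {K : LowerSet (Finset (Fin n))}

/-- An unstable configuration has a non-face of coinciding points. -/
theorem exists_notMem_of_notMem_stableVec (hempty : ∅ ∈ K) {u : Fin n × Fin 2 → ℂ}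
    (hu : u ∈ homogCoords (Fin n)) (hs : u ∉ stableVec K) :
    ∃ j, (Finset.univ.filter fun l => wedge (fun s => u (l, s)) (fun s => u (j, s)) = 0) ∉ K := by
  have : ∃ I : Finset (Fin n), (∀ i ∈ I, ∀ j ∈ I, configOfVec u i = configOfVec u j) ∧ I ∉ K := by
    by_contra! hcon
    exact hs ⟨hu, hcon⟩
  obtain ⟨I, hI, hIK⟩ := this
  obtain ⟨j, hj⟩ : I.Nonempty := by
    rw [Finset.nonempty_iff_ne_empty]
    rintro rfl
    exact hIK hempty
  refine ⟨j, fun h => hIK (K.lower (fun l hl => ?_) h)⟩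
  exact Finset.mem_filter.2 ⟨Finset.mem_univ _, (wedge_eq_zero_iff (hu l) (hu j)).2 (hI l hl j hj)⟩

theorem exists_tendsto_of_isCompact {X Y : Type*} [TopologicalSpace Y] (F : Ultrafilter X)
    {s : Set Y} (hs : IsCompact s) {f : X → Y} (hf : ∀ᶠ x in F, f x ∈ s) :
    ∃ y ∈ s, Tendsto f F (𝓝 y) := by
  obtain ⟨y, hy, h⟩ := hs.ultrafilter_le_nhds' (F.map f) hf
  exact ⟨y, hy, h⟩

variable [Nonempty (ModuliSpace K)]

theorem ofVec_eq_of_mulVec {v w : Fin n × Fin 2 → ℂ} (hv : v ∈ stableVec K)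
    {A : Matrix (Fin 2) (Fin 2) ℂ} (hA : A.det ≠ 0) {c : Fin n → ℂ} (hc : ∀ l, c l ≠ 0)
    (hw : ∀ l, (fun s => w (l, s)) = c l • A.mulVec fun s => v (l, s)) :
    w ∈ stableVec K ∧ ofVec K w = ofVec K v := by
  obtain ⟨g, hg⟩ := exists_psl hA
  have hgw : g • configOfVec v = configOfVec w := by
    funext l
    change g • ProjLine.ofVec _ = ProjLine.ofVec _
    rw [hg _ (hv.1 l), hw, ofVec_smul (hc l)]
  have hmem : w ∈ stableVec K := by
    refine ⟨fun l => ?_, ?_⟩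
    · rw [hw]
      exact smul_ne_zero (hc l) (mulVec_ne_zero hA (hv.1 l))
    · rw [Set.mem_preimage, ← hgw]
      exact (Stable K).smul_mem g hv.2
  refine ⟨hmem, ?_⟩
  exact (ofConfig_eq_iff hmem.2 hv.2).2 ⟨g, hgw⟩

/-- Rescaling around a cluster `I` of points that is not a face breaks it up. -/
theorem exists_rescaling {X : Type*} (F : Ultrafilter X) {v : X → Fin n × Fin 2 → ℂ}
    {u : Fin n × Fin 2 → ℂ} (hv : ∀ᶠ x in F, v x ∈ stableVec K) (hlim : Tendsto v F (𝓝 u))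
    (hu : u ∈ homogCoords (Fin n)) {I : Finset (Fin n)} (hI : I ∉ K)
    (hmem : ∀ l, l ∈ I ↔ u (l, 0) = 0) {l₀ : Fin n} (hl₀ : l₀ ∈ I) :
    ∃ (v' : X → Fin n × Fin 2 → ℂ) (u' : Fin n × Fin 2 → ℂ),
      (∀ᶠ x in F, v' x ∈ stableVec K ∧ ofVec K (v' x) = ofVec K (v x)) ∧
      Tendsto v' F (𝓝 u') ∧ (∀ l ∉ I, u' (l, 0) ≠ 0 ∧ u' (l, 1) = 0) ∧
      (∀ l ∈ I, u' (l, 1) = 1) ∧ ∃ l ∈ I, u' (l, 0) ≠ u' (l₀, 0) := by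
  have hcoord (a : Fin n × Fin 2) : Tendsto (fun x => v x a) F (𝓝 (u a)) :=
    ((continuous_apply a).tendsto u).comp hlim
  have hu1 : ∀ l ∈ I, u (l, 1) ≠ 0 := by
    intro l hl h1
    refine hu l (funext fun s => ?_)
    fin_cases s
    · exact (hmem l).1 hl
    · exact h1
  have hne : ∀ᶠ x in F, ∀ l ∈ I, v x (l, 1) ≠ 0 := by
    rw [Filter.eventually_all_finset]
    exact fun l hl => (hcoord (l, 1)).eventually_ne (hu1 l hl)
  -- Affine coordinates near the point `0 = [0 : 1]`, to which the cluster `I` converges.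
  set z : X → Fin n → ℂ := fun x l => v x (l, 0) / v x (l, 1) with hz
  have hzlim : ∀ l ∈ I, Tendsto (fun x => z x l) F (𝓝 0) := by
    intro l hl
    have := (hcoord (l, 0)).div (hcoord (l, 1)) (hu1 l hl)
    rwa [(hmem l).1 hl, zero_div] at this
  -- The spread of the cluster. Dividing by it leaves bounded positions whose norms sum to `1`.
  set r : X → ℝ := fun x => ∑ l ∈ I, ‖z x l - z x l₀‖ with hr
  have hrlim : Tendsto r F (𝓝 0) := by
    have : Tendsto r F (𝓝 (∑ l ∈ I, ‖(0 : ℂ) - 0‖)) :=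
      tendsto_finsetSum I fun l hl => ((hzlim l hl).sub (hzlim l₀ hl₀)).norm
    simpa using this
  -- Zero spread would make the non-face `I` coincide in a stable configuration.
  have hr0 : ∀ᶠ x in F, r x ≠ 0 := by
    filter_upwards [hv, hne] with x hx hnex h0
    refine hI (mem_of_wedge_eq_zero hx fun i hi j hj => ?_)
    have h1 : ∀ l ∈ I, z x l = z x l₀ := by
      intro l hl
      have := (Finset.sum_eq_zero_iff_of_nonneg fun l _ => norm_nonneg _).1 h0 l hl
      rwa [norm_eq_zero, sub_eq_zero] at this
    have h2 : z x i = z x j := (h1 i hi).trans (h1 j hj).symm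
    simp only [hz] at h2
    rw [div_eq_div_iff (hnex i hi) (hnex j hj)] at h2
    simp only [wedge]
    linear_combination h2
  have hball : ∀ l, ∃ ζ : ℂ, l ∈ I → Tendsto (fun x => (z x l - z x l₀) / (r x : ℂ)) F (𝓝 ζ) := by
    intro l
    by_cases hl : l ∈ I
    · obtain ⟨ζ, -, h⟩ := exists_tendsto_of_isCompact F
        (isCompact_closedBall (0 : ℂ) 1) (f := fun x => (z x l - z x l₀) / (r x : ℂ)) <| by
          filter_upwards [hr0] with x hx
          have hrpos : 0 ≤ r x := Finset.sum_nonneg fun _ _ => norm_nonneg _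
          rw [mem_closedBall_zero_iff, norm_div, Complex.norm_real, Real.norm_of_nonneg hrpos]
          exact div_le_one_of_le₀ (Finset.single_le_sum (f := fun l => ‖z x l - z x l₀‖)
            (fun _ _ => norm_nonneg _) hl) hrpos
      exact ⟨ζ, fun _ => h⟩
    · exact ⟨0, fun h => absurd h hl⟩
  choose ζ hζ using hball
  have hζ₀ : ζ l₀ = 0 := by
    refine tendsto_nhds_unique (hζ l₀ hl₀) ?_
    simp
  -- The norm sum survives in the limit, so some `ζ l` is nonzero while `ζ l₀ = 0`: the cluster has
  -- split.
  have hζsum : ∑ l ∈ I, ‖ζ l‖ = 1 := by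
    refine tendsto_nhds_unique (tendsto_finsetSum I fun l hl => (hζ l hl).norm) ?_
    refine tendsto_const_nhds.congr' ?_
    filter_upwards [hr0] with x hx
    have hrpos : 0 ≤ r x := Finset.sum_nonneg fun _ _ => norm_nonneg _
    simp only [norm_div, Complex.norm_real, Real.norm_of_nonneg hrpos]
    rw [← Finset.sum_div]
    exact (div_self hx).symm
  -- The substitution `z ↦ (z - z_{l₀}) / r`. Vectors in `I` are scaled to last coordinate `1`; the
  -- others are left unscaled, so that they tend to `[u₀ : 0] = ∞`.
  refine ⟨fun x a => if a.1 ∈ I then (![(z x a.1 - z x l₀) / (r x : ℂ), 1] : Fin 2 → ℂ) a.2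
    else (![v x (a.1, 0) - z x l₀ * v x (a.1, 1), r x * v x (a.1, 1)] : Fin 2 → ℂ) a.2,
    fun a => if a.1 ∈ I then (![ζ a.1, 1] : Fin 2 → ℂ) a.2
    else (![u (a.1, 0), 0] : Fin 2 → ℂ) a.2, ?_, ?_, ?_, ?_, ?_⟩
  · filter_upwards [hv, hne, hr0] with x hx hnex hrx
    have hrx' : (r x : ℂ) ≠ 0 := by exact_mod_cast hrx
    refine ofVec_eq_of_mulVec hx (A := !![1, -z x l₀; 0, r x]) (by simpa using hrx)
      (c := fun l => if l ∈ I then (v x (l, 1) * r x)⁻¹ else 1) (fun l => ?_) (fun l => ?_)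
    · split_ifs with hl
      · exact inv_ne_zero (mul_ne_zero (hnex l hl) hrx')
      · exact one_ne_zero
    · split_ifs with hl
      · have hl1 := hnex l hl
        ext s
        fin_cases s
        · simp [dotProduct, hz]
          field_simp
          ring
        · simp [dotProduct]
          field_simp
      · ext s
        fin_cases s
        · simp [dotProduct]
          ring
        · simp [dotProduct]
  · refine tendsto_pi_nhds.2 fun ⟨l, s⟩ => ?_
    by_cases hl : l ∈ I
    · simp only [hl, if_true]
      fin_cases s
      · simpa using hζ l hl
      · simp
    · simp only [hl, if_false]
      fin_cases s
      · simpa using (hcoord (l, 0)).sub ((hzlim l₀ hl₀).mul (hcoord (l, 1)))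
      · have h : Tendsto (fun x => (r x : ℂ)) F (𝓝 0) := by
          rw [← Complex.ofReal_zero]
          exact (Complex.continuous_ofReal.tendsto 0).comp hrlim
        simpa using h.mul (hcoord (l, 1))
  · intro l hl
    simp only [hl, if_false]
    exact ⟨fun h => hl ((hmem l).2 (by simpa using h)), by simp⟩
  · intro l hl
    simp [hl]
  · by_contra! hcon
    have hall : ∀ l ∈ I, ζ l = 0 := by
      intro l hl
      have := hcon l hl
      simpa [hl, hl₀, hζ₀] using this
    rw [Finset.sum_eq_zero fun l hl => by rw [hall l hl, norm_zero]] at hζsum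
    exact zero_ne_one hζsum

/-- Strong induction on the size of a collapsed non-face: each rescaling either produces a stable
limit or leaves a strictly smaller collapsed non-face. -/
theorem exists_stable_limit_of_cluster (hASD : IsAlexanderSelfDual K)
    {X : Type*} (F : Ultrafilter X) (y : X → ModuliSpace K) (N : ℕ) :
    ∀ (v : X → Fin n × Fin 2 → ℂ) (u : Fin n × Fin 2 → ℂ) (b : Fin 2 → ℂ),
      (∀ᶠ x in F, v x ∈ stableVec K ∧ ofVec K (v x) = y x) → Tendsto v F (𝓝 u) →
      u ∈ homogCoords (Fin n) → b ≠ 0 →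
      (Finset.univ.filter fun l => wedge (fun s => u (l, s)) b = 0) ∉ K →
      (Finset.univ.filter fun l => wedge (fun s => u (l, s)) b = 0).card = N →
      ∃ (v' : X → Fin n × Fin 2 → ℂ) (u' : Fin n × Fin 2 → ℂ), u' ∈ stableVec K ∧
        (∀ᶠ x in F, v' x ∈ stableVec K ∧ ofVec K (v' x) = y x) ∧ Tendsto v' F (𝓝 u') := by
  induction N using Nat.strong_induction_on with
  | _ N ih =>
  intro v u b hv hlim hu hb hI hN
  set I := Finset.univ.filter fun l => wedge (fun s => u (l, s)) b = 0 with hIdef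
  obtain ⟨l₀, hl₀⟩ : I.Nonempty := by
    rw [Finset.nonempty_iff_ne_empty]
    intro h
    exact hI (h ▸ empty_mem hASD)
  -- The first row is `wedge · b`, so `B` moves the point `b` to `0`. The conjugates make the
  -- determinant `|b 0|² + |b 1|²`, which is nonzero.
  let B : Matrix (Fin 2) (Fin 2) ℂ := !![b 1, -b 0; starRingEnd ℂ (b 0), starRingEnd ℂ (b 1)]
  have hB : B.det ≠ 0 := by
    have : B.det = ((Complex.normSq (b 1) + Complex.normSq (b 0) : ℝ) : ℂ) := by
      simp [B, Matrix.det_fin_two_of, Complex.mul_conj]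
    rw [this]
    norm_cast
    intro h0
    have h1 := Complex.normSq_nonneg (b 1)
    have h2 := Complex.normSq_nonneg (b 0)
    refine hb (funext fun s => ?_)
    fin_cases s
    · exact Complex.normSq_eq_zero.1 (le_antisymm (by simp only [Fin.zero_eta]; linarith) h2)
    · exact Complex.normSq_eq_zero.1 (le_antisymm (by simp only [Fin.mk_one]; linarith) h1)
  let T : (Fin n × Fin 2 → ℂ) → Fin n × Fin 2 → ℂ := fun v a => B.mulVec (fun s => v (a.1, s)) a.2
  have hT : Continuous T := by
    refine continuous_pi fun a => ?_
    simp only [T, Matrix.mulVec, dotProduct]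
    fun_prop
  have hTv : ∀ᶠ x in F, T (v x) ∈ stableVec K ∧ ofVec K (T (v x)) = y x := by
    filter_upwards [hv] with x hx
    have := ofVec_eq_of_mulVec (w := T (v x)) hx.1 hB (c := fun _ => 1) (fun _ => one_ne_zero)
      fun l => by rw [one_smul]
    exact ⟨this.1, this.2.trans hx.2⟩
  have hTu : T u ∈ homogCoords (Fin n) := fun l => mulVec_ne_zero hB (hu l)
  have hmem (l : Fin n) : l ∈ I ↔ T u (l, 0) = 0 := by
    have : T u (l, 0) = wedge (fun s => u (l, s)) b := by
      simp [T, B, Matrix.mulVec, dotProduct, wedge]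
      ring
    rw [this, hIdef, Finset.mem_filter]
    simp
  obtain ⟨v', u', hv', hlim', hout, hin, l₁, hl₁, hl₁'⟩ := exists_rescaling F
    (hTv.mono fun _ h => h.1) ((hT.tendsto u).comp hlim) hTu hI hmem hl₀
  have hvy : ∀ᶠ x in F, v' x ∈ stableVec K ∧ ofVec K (v' x) = y x := by
    filter_upwards [hv', hTv] with x h1 h2
    exact ⟨h1.1, h1.2.trans h2.2⟩
  have hu' : u' ∈ homogCoords (Fin n) := by
    intro l h0
    by_cases hl : l ∈ I
    · have := congrFun h0 1
      simp [hin l hl] at this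
    · exact (hout l hl).1 (congrFun h0 0)
  by_cases hs : u' ∈ stableVec K
  · exact ⟨v', u', hs, hvy, hlim'⟩
  obtain ⟨j, hj⟩ := exists_notMem_of_notMem_stableVec (empty_mem hASD) hu' hs
  -- A cluster around `j ∈ I` stays away from `∞`, so it lies in `I`; it cannot contain both `l₀`
  -- and `l₁`, which have been separated.
  by_cases hjI : j ∈ I
  · refine ih _ ?_ v' u' (fun s => u' (j, s)) hvy hlim' hu' (hu' j) hj rfl
    rw [← hN]
    have hiff (l : Fin n) (hl : wedge (fun s => u' (l, s)) (fun s => u' (j, s)) = 0) :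
        l ∈ I ∧ u' (l, 0) = u' (j, 0) := by
      simp only [wedge, hin j hjI] at hl
      by_cases hlI : l ∈ I
      · rw [hin l hlI] at hl
        exact ⟨hlI, by linear_combination hl⟩
      · rw [(hout l hlI).2] at hl
        exact absurd (by linear_combination hl) (hout l hlI).1
    refine Finset.card_lt_card ⟨fun l hl => (hiff l (Finset.mem_filter.1 hl).2).1, fun hsub => ?_⟩
    have h1 := (hiff l₁ (Finset.mem_filter.1 (hsub hl₁)).2).2
    have h2 := (hiff l₀ (Finset.mem_filter.1 (hsub hl₀)).2).2
    exact hl₁' (h1.trans h2.symm)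
  · exfalso
    -- For `j ∉ I` the cluster sits at `∞`, inside `Iᶜ`, which is a face because `I` is not one.
    have hIc : Iᶜ ∈ K := by
      by_contra h
      exact hI ((mem_iff_compl_notMem hASD I).2 h)
    refine hj (K.lower (fun l hl => ?_) hIc)
    rw [Finset.mem_compl]
    intro hlI
    have := (Finset.mem_filter.1 hl).2
    simp only [wedge, (hout j hjI).2, hin l hlI] at this
    exact (hout j hjI).1 (by linear_combination -this)

/-- Scaling each vector to norm one puts the representatives in a product of spheres, where an
ultrafilter converges to nonzero vectors. An unstable limit is then repaired by rescaling. -/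
theorem exists_stable_limit (hASD : IsAlexanderSelfDual K)
    {X : Type*} (F : Ultrafilter X) (y : X → ModuliSpace K) :
    ∃ (v : X → Fin n × Fin 2 → ℂ) (u : Fin n × Fin 2 → ℂ), u ∈ stableVec K ∧
      (∀ᶠ x in F, v x ∈ stableVec K ∧ ofVec K (v x) = y x) ∧ Tendsto v F (𝓝 u) := by
  choose w hw hwy using fun x => exists_ofVec (y x)
  let v : X → Fin n × Fin 2 → ℂ := fun x a => (‖fun s => w x (a.1, s)‖⁻¹ : ℂ) * w x a
  have hv (x : X) : v x ∈ stableVec K ∧ ofVec K (v x) = y x := by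
    have := ofVec_eq_of_mulVec (w := v x) (hw x) (A := 1) (by simp)
      (c := fun l => (‖fun s => w x (l, s)‖⁻¹ : ℂ))
      (fun l => by simpa using (hw x).1 l) (fun l => by rw [Matrix.one_mulVec]; rfl)
    exact ⟨this.1, this.2.trans (hwy x)⟩
  have hnorm (x : X) (l : Fin n) : ‖fun s => v x (l, s)‖ = 1 := by
    have : (fun s => v x (l, s)) = (‖fun s => w x (l, s)‖⁻¹ : ℂ) • fun s => w x (l, s) := rfl
    rw [this, norm_smul, norm_inv, Complex.norm_real, norm_norm]
    exact inv_mul_cancel₀ (norm_ne_zero_iff.2 ((hw x).1 l))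
  have hsphere (l : Fin n) : ∃ a ∈ Metric.sphere (0 : Fin 2 → ℂ) 1,
      Tendsto (fun x s => v x (l, s)) F (𝓝 a) :=
    exists_tendsto_of_isCompact F (isCompact_sphere _ _)
      (Eventually.of_forall fun x => by simpa using hnorm x l)
  choose a ha hlim using hsphere
  have hlim' : Tendsto v F (𝓝 fun b => a b.1 b.2) :=
    tendsto_pi_nhds.2 fun b => tendsto_pi_nhds.1 (hlim b.1) b.2
  have hu : (fun b : Fin n × Fin 2 => a b.1 b.2) ∈ homogCoords (Fin n) := by
    intro l h0
    have h1 : a l = 0 := h0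
    have := ha l
    simp [h1] at this
  by_cases hs : (fun b : Fin n × Fin 2 => a b.1 b.2) ∈ stableVec K
  · exact ⟨v, _, hs, Eventually.of_forall hv, hlim'⟩
  · obtain ⟨j, hj⟩ := exists_notMem_of_notMem_stableVec (empty_mem hASD) hu hs
    exact exists_stable_limit_of_cluster hASD F y _ v _ _ (Eventually.of_forall hv) hlim' hu
      (hu j) hj rfl

theorem continuousOn_ofVec : ContinuousOn (ofVec K) (stableVec K) := by
  have h := (isGeometry_holomorphic.isQuotientOn_ofVec K).toIsMorphismOn
  refine (continuousOn_open_iff h.isOpen).2 fun O hO => h.isOpen_inter_preimage O hO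

theorem compactSpace (hASD : IsAlexanderSelfDual K) :
    CompactSpace (ModuliSpace K) := by
  refine ⟨isCompact_iff_ultrafilter_le_nhds.2 fun F _ => ?_⟩
  obtain ⟨v, u, hu, hv, hlim⟩ := exists_stable_limit hASD F id
  refine ⟨ofVec K u, trivial, ?_⟩
  have hopen : IsOpen (stableVec K) :=
    (isGeometry_holomorphic.isQuotientOn_ofVec K).toIsMorphismOn.isOpen
  have h := ((continuousOn_ofVec (K := K)).continuousAt (hopen.mem_nhds hu)).tendsto.comp hlim
  exact h.congr' (hv.mono fun x hx => hx.2)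

end ModuliSpace

end

/-! ### The manifold, the smooth variety and the final assembly. -/

noncomputable section

open SpaceWithFunctions ProjLine

theorem contDiff_mvPolynomial_eval {σ : Type*} [Fintype σ] (P : MvPolynomial σ ℂ) :
    ContDiff ℂ ω fun x : σ → ℂ => MvPolynomial.eval x P := by
  induction P using MvPolynomial.induction_on with
  | C a => simpa using contDiff_const
  | add p q hp hq => simpa using hp.add hq
  | mul_X p s hp => simpa using hp.mul (contDiff_apply ℂ ℂ s)

theorem isOpen_of_isOpen_zariski {σ : Type*} {U : Set (σ → ℂ)}
    (hU : IsOpen[zariskiTopology σ] U) : IsOpen U := by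
  induction hU with
  | basic O hO =>
    obtain ⟨P, rfl⟩ := hO
    exact isOpen_ne_fun (MvPolynomial.continuous_eval P) continuous_const
  | univ => exact isOpen_univ
  | inter A B _ _ hA hB => exact hA.inter hB
  | sUnion A _ hA => exact isOpen_sUnion hA

theorem contDiffOn_of_mem_affine {σ : Type*} [Fintype σ] {U : Set (σ → ℂ)} {f : (σ → ℂ) → ℂ}
    (hf : f ∈ (affine σ).regular U) : ContDiffOn ℂ ω f U := by
  intro x hx
  obtain ⟨V, hV, hxV, P, Q, h⟩ := hf x hx
  have hPQ : ContDiffWithinAt ℂ ω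
      (fun y => MvPolynomial.eval y P / MvPolynomial.eval y Q) U x :=
    (contDiff_mvPolynomial_eval P).contDiffWithinAt.div
      (contDiff_mvPolynomial_eval Q).contDiffWithinAt (h x hxV hx).1
  refine hPQ.congr_of_eventuallyEq ?_ (h x hxV hx).2
  filter_upwards [mem_nhdsWithin_of_mem_nhds ((isOpen_of_isOpen_zariski hV).mem_nhds hxV),
    self_mem_nhdsWithin] with y hyV hyU using (h y hyV hyU).2

namespace ModuliSpace

variable {n : ℕ} {K : LowerSet (Finset (Fin n))}

theorem continuousOn_of_mem_hol {U : Set (ModuliSpace K)} (hU : IsOpen U) {f : ModuliSpace K → ℂ}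
    (hf : f ∈ (hol K).regular U) : ContinuousOn f U := by
  have h := isGeometry_holomorphic.hasCoordinates_moduli K Unit U hU (fun x _ => f x) fun _ => hf
  refine (continuousOn_open_iff hU).2 fun O hO => ?_
  exact h.isOpen_inter_preimage ((fun z => z ()) ⁻¹' O) (hO.preimage (continuous_apply ()))

variable [Nonempty (ModuliSpace K)]

theorem isOpen_of_isOpen_alg {U : Set (ModuliSpace K)} (hU : IsOpen[(alg K).top] U) :
    IsOpen U := by
  refine (isGeometry_holomorphic.isQuotientOn_ofVec K).isOpen_of_preimage U ?_
  exact isOpen_of_isOpen_zariski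
    ((isGeometry_affine.isQuotientOn_ofVec K).isOpen_inter_preimage U hU)

/-- In the holomorphic geometry the separating sum `∑ f_a g_a` is continuous. It is nonzero on a box
around `(x, y)` and zero on the diagonal, so the sides of the box are disjoint. -/
theorem t2Space (hASD : IsAlexanderSelfDual K) : T2Space (ModuliSpace K) := by
  refine ⟨fun x y hxy => ?_⟩
  obtain ⟨U, V, hU, hV, hxU, hyV, m, f, g, hf, hg, hne, hzero⟩ :=
    isSeparated_moduli hASD isGeometry_holomorphic x y hxy
  have hU' : IsOpen U := hU
  have hV' : IsOpen V := hV
  have hcont : ContinuousOn (fun p : ModuliSpace K × ModuliSpace K => ∑ a, f a p.1 * g a p.2)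
      (U ×ˢ V) := by
    refine continuousOn_finsetSum _ fun a _ => ?_
    exact ((continuousOn_of_mem_hol hU' (hf a)).comp continuousOn_fst fun p hp => hp.1).mul
      ((continuousOn_of_mem_hol hV' (hg a)).comp continuousOn_snd fun p hp => hp.2)
  have hO := hcont.isOpen_inter_preimage (hU'.prod hV') (isOpen_compl_singleton (x := (0 : ℂ)))
  obtain ⟨A, B, hA, hB, hxA, hyB, hAB⟩ := isOpen_prod_iff.1 hO x y ⟨⟨hxU, hyV⟩, hne⟩
  refine ⟨A, B, hA, hB, hxA, hyB, Set.disjoint_left.2 fun z hzA hzB => ?_⟩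
  obtain ⟨hz, hz'⟩ := hAB (Set.mk_mem_prod hzA hzB)
  exact hz' (hzero z hz)

theorem compactSpace_alg (hASD : IsAlexanderSelfDual K) :
    @CompactSpace (ModuliSpace K) (alg K).top := by
  have := compactSpace hASD
  have hcont : @Continuous _ _ _ (alg K).top (id : ModuliSpace K → ModuliSpace K) :=
    @Continuous.mk _ _ _ (alg K).top _ fun _ h => isOpen_of_isOpen_alg h
  refine @CompactSpace.mk _ (alg K).top ?_
  simpa using @IsCompact.image _ _ _ (alg K).top _ _ isCompact_univ hcont

/-- The moduli space is the image of an open subset of affine space, in which nonempty open sets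
meet. -/
theorem irreducibleSpace_alg : @IrreducibleSpace (ModuliSpace K) (alg K).top := by
  let _ := (alg K).top
  refine @IrreducibleSpace.mk _ _ ⟨fun A B hA hB hA' hB' => ?_⟩ inferInstance
  have hq := isGeometry_affine.isQuotientOn_ofVec K
  have hne (O : Set (ModuliSpace K)) (h : (Set.univ ∩ O).Nonempty) :
      (stableVec K ∩ ofVec K ⁻¹' O).Nonempty := by
    obtain ⟨x, -, hx⟩ := h
    obtain ⟨v, hv, rfl⟩ := exists_ofVec x
    exact ⟨v, hv, hx⟩
  obtain ⟨v, hvA, hvB⟩ := zariski_inter_nonempty (hq.isOpen_inter_preimage A hA)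
    (hq.isOpen_inter_preimage B hB) (hne A hA') (hne B hB')
  exact ⟨ofVec K v, trivial, hvA.2, hvB.2⟩

theorem isSmoothVariety_alg (hASD : IsAlexanderSelfDual K) :
    (alg K).IsSmoothVariety (n - 3) where
  quasiCompact := compactSpace_alg hASD
  irreducible := irreducibleSpace_alg
  separated := isSeparated_moduli hASD isGeometry_affine
  smooth x := by
    obtain ⟨V, L, ρ, -, ⟨z, hz, rfl⟩, h⟩ := exists_isLocalChart hASD (σ := Fin (0 + (n - 3)))
      (by simp) x
    obtain ⟨-, hc⟩ := h _ isGeometry_affine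
    -- Shrinking the chart to a principal open set makes it a locus with no equations (`c = 0`), for
    -- which the Jacobian criterion is vacuous.
    obtain ⟨P, hP, hPV⟩ := exists_basic_subset hc.morphism.isOpen hz
    have hlocus : locus (fun a : Fin 0 => a.elim0) P = {y | MvPolynomial.eval y P ≠ 0} := by
      ext y
      simp [locus]
    have hc' := hc.mono (V' := locus (fun a : Fin 0 => a.elim0) P)
      (by rw [hlocus]; exact isOpen_zariski_ne P) (by rwa [hlocus])
    exact ⟨0, fun a => a.elim0, P, fun y _ => linearIndependent_empty_type, _,
      ⟨⟨z, by rw [hlocus]; exact hP⟩, rfl⟩, hc'.isOpenImmersion⟩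

/-- A holomorphic chart as a partial homeomorphism. -/
def partialHomeomorph {σ : Type} [Fintype σ] {V : Set (σ → ℂ)} {φ : (σ → ℂ) → ModuliSpace K}
    {ρ : ModuliSpace K → σ → ℂ} (h : IsLocalChart (holomorphic σ) (moduli @holomorphic K) V φ ρ) :
    OpenPartialHomeomorph (ModuliSpace K) (σ → ℂ) where
  toFun := ρ
  invFun := φ
  source := φ '' V
  target := V
  map_source' := by
    rintro _ ⟨z, hz, rfl⟩
    rwa [h.left_inv z hz]
  map_target' z hz := ⟨z, hz, rfl⟩
  left_inv' := by
    rintro _ ⟨z, hz, rfl⟩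
    rw [h.left_inv z hz]
  right_inv' := h.left_inv
  open_source := h.inverse.isOpen
  open_target := h.morphism.isOpen
  continuousOn_toFun := (continuousOn_open_iff h.inverse.isOpen).2 h.inverse.isOpen_inter_preimage
  continuousOn_invFun :=
    (continuousOn_open_iff h.morphism.isOpen).2 h.morphism.isOpen_inter_preimage

theorem exists_chartedSpace (hASD : IsAlexanderSelfDual K) :
    ∃ _ : ChartedSpace (Fin (n - 3) → ℂ) (ModuliSpace K),
      IsManifold 𝓘(ℂ, Fin (n - 3) → ℂ) ω (ModuliSpace K) ∧
      ∀ U : Set (ModuliSpace K), IsOpen U → ∀ f : ModuliSpace K → ℂ,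
        MDifferentiableOn 𝓘(ℂ, Fin (n - 3) → ℂ) 𝓘(ℂ, ℂ) f U ↔ f ∈ (hol K).regular U := by
  choose V L ρ _ hx h using fun x : ModuliSpace K =>
    exists_isLocalChart hASD (Fintype.card_fin (n - 3)) x
  have hhol (x : ModuliSpace K) := (h x _ isGeometry_holomorphic).2
  have halg (x : ModuliSpace K) := (h x _ isGeometry_affine).2
  let cs : ChartedSpace (Fin (n - 3) → ℂ) (ModuliSpace K) :=
    { atlas := Set.range fun x => partialHomeomorph (hhol x)
      chartAt := fun x => partialHomeomorph (hhol x)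
      mem_chart_source := hx
      chart_mem_atlas := fun x => ⟨x, rfl⟩ }
  have hman : IsManifold 𝓘(ℂ, Fin (n - 3) → ℂ) ω (ModuliSpace K) := by
    refine isManifold_of_contDiffOn _ _ _ ?_
    rintro _ _ ⟨x, rfl⟩ ⟨y, rfl⟩
    -- The charts are the same in both geometries, so the transition maps are locally quotients of
    -- polynomials, hence analytic.
    have hm := (halg y).inverse.comp (halg x).morphism
    have : ContDiffOn ℂ ω (ρ y ∘ ofVec K ∘ L x)
        (V x ∩ (ofVec K ∘ L x) ⁻¹' ((ofVec K ∘ L y) '' V y)) :=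
      contDiffOn_pi.2 fun s => contDiffOn_of_mem_affine (isGeometry_affine.coord_comp_mem hm s)
    simpa [OpenPartialHomeomorph.trans_source] using! this
  have hman1 : IsManifold 𝓘(ℂ, Fin (n - 3) → ℂ) 1 (ModuliSpace K) := IsManifold.of_le le_top
  -- Differentiability at a point can be tested in any chart around it, not only in the preferred
  -- one, since transition maps are differentiable.
  have key (f : ModuliSpace K → ℂ) (x : ModuliSpace K) (z : Fin (n - 3) → ℂ) (hz : z ∈ V x) :
      MDifferentiableAt 𝓘(ℂ, Fin (n - 3) → ℂ) 𝓘(ℂ, ℂ) f (ofVec K (L x z)) ↔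
        ContinuousAt f (ofVec K (L x z)) ∧ DifferentiableAt ℂ (f ∘ ofVec K ∘ L x) z := by
    have h1 := mdifferentiableAt_iff_of_mem_source (I := 𝓘(ℂ, Fin (n - 3) → ℂ)) (I' := 𝓘(ℂ, ℂ))
      (f := f) (x := x) (x' := ofVec K (L x z)) (y := f (ofVec K (L x z)))
      ⟨z, hz, rfl⟩ (Set.mem_univ _)
    rw [h1]
    have h2 : extChartAt 𝓘(ℂ, Fin (n - 3) → ℂ) x (ofVec K (L x z)) = z := (hhol x).left_inv z hz
    rw [h2]
    refine and_congr_right fun _ => ?_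
    simp only [modelWithCornersSelf_coe, Set.range_id, differentiableWithinAt_univ]
    exact Iff.rfl
  refine ⟨cs, hman, fun U hU f => ⟨fun hf => ?_, fun hf x hxU => ?_⟩⟩
  · refine (hol K).glue hU fun x hxU => ?_
    have hd : f ∘ ofVec K ∘ L x ∈
        (holomorphic (Fin (n - 3))).regular (V x ∩ (ofVec K ∘ L x) ⁻¹' U) :=
      fun z hz => ((key f x z hz.1).1
        ((hf _ hz.2).mdifferentiableAt (hU.mem_nhds hz.2))).2.differentiableWithinAt
    have hm := (hhol x).inverse.comp_mem _ ((hhol x).morphism.isOpen_inter_preimage U hU) _ hd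
    refine ⟨(ofVec K ∘ L x) '' V x ∩ U, ?_, ⟨hx x, hxU⟩, Set.inter_subset_right, ?_⟩
    · exact (hol K).top.isOpen_inter _ _ (hhol x).inverse.isOpen hU
    · refine (hol K).congr ?_ ((hol K).restrict ?_ hm)
      · rintro _ ⟨⟨z, hz, rfl⟩, -⟩
        simp only [Function.comp_apply]
        rw [show ρ x (ofVec K (L x z)) = z from (hhol x).left_inv z hz]
      · rintro _ ⟨⟨z, hz, rfl⟩, hzU⟩
        refine ⟨⟨z, hz, rfl⟩, ?_⟩
        rw [Set.mem_preimage, (hhol x).left_inv z hz]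
        exact ⟨hz, hzU⟩
  · obtain ⟨z, hz, hzx⟩ := hx x
    have hd : DifferentiableOn ℂ (f ∘ ofVec K ∘ L x) (V x ∩ (ofVec K ∘ L x) ⁻¹' U) :=
      (hhol x).morphism.comp_mem U hU f hf
    have hzU : (ofVec K ∘ L x) z ∈ U := by rwa [hzx]
    have hopen : IsOpen (V x ∩ (ofVec K ∘ L x) ⁻¹' U) :=
      (hhol x).morphism.isOpen_inter_preimage U hU
    refine MDifferentiableAt.mdifferentiableWithinAt ?_
    rw [← hzx]
    exact (key f x z hz).2 ⟨(continuousOn_of_mem_hol hU hf).continuousAt (hU.mem_nhds hzU),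
      hd.differentiableAt (hopen.mem_nhds ⟨hz, hzU⟩)⟩

theorem chart_eq (i j k : Fin n) :
    chart K i j k = fun w => (ofConfig K ∘ normalized i j k) w.1 :=
  funext fun w => (ofConfig_of_mem w.2).symm

theorem range_chart {i j k : Fin n} (hij : i ≠ j) (hjk : j ≠ k) (hik : i ≠ k) :
    Set.range (chart K i j k) = distinctLocus K i j k := by
  rw [← image_normalizedSet hij hjk hik, chart_eq, Set.image_eq_range]

theorem isOpenImmersion_chart {G : (σ : Type) → [Fintype σ] → SpaceWithFunctions (σ → ℂ)}
    (hG : IsGeometry G) {i j k : Fin n} (hij : i ≠ j) (hjk : j ≠ k) (hik : i ≠ k) :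
    IsOpenImmersion ((config G (FreeIndex i j k)).comap Subtype.val) (moduli G K)
      (chart K i j k) := by
  rw [chart_eq]
  exact (hG.isLocalChart_normalized K hij hjk hik).isOpenImmersion

end ModuliSpace

end

theorem theorem2p6 (n : ℕ) (K : LowerSet (Finset (Fin n)))
    (hvertices : ∀ i : Fin n, {i} ∈ K) (hASD : IsAlexanderSelfDual K) :
    -- compact and Hausdorff in the classical quotient topology
    CompactSpace (ModuliSpace K) ∧ T2Space (ModuliSpace K) ∧
    SecondCountableTopology (ModuliSpace K) ∧
    -- a complex manifold whose holomorphic functions are those that pull back to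
    -- holomorphic functions of the configuration
    (∃ _ : ChartedSpace (Fin (n - 3) → ℂ) (ModuliSpace K),
      IsManifold 𝓘(ℂ, Fin (n - 3) → ℂ) ω (ModuliSpace K) ∧
      ∀ U : Set (ModuliSpace K), IsOpen U → ∀ f : ModuliSpace K → ℂ,
        MDifferentiableOn 𝓘(ℂ, Fin (n - 3) → ℂ) 𝓘(ℂ, ℂ) f U ↔
          f ∈ (ModuliSpace.hol K).regular U) ∧
    -- a smooth algebraic variety
    (ModuliSpace.alg K).IsSmoothVariety (n - 3) ∧
    -- the sets `U_{i,j,k}` cover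
    (∀ x : ModuliSpace K, ∃ i j k : Fin n, i ≠ j ∧ j ≠ k ∧ i ≠ k ∧
      x ∈ ModuliSpace.distinctLocus K i j k) ∧
    -- normalizing `p_i = 0`, `p_j = 1`, `p_k = ∞` identifies `U_{i,j,k}`, algebraically and
    -- holomorphically, with an open subset of a product of `n - 3` projective lines
    (∀ i j k : Fin n, i ≠ j → j ≠ k → i ≠ k →
      Set.range (ModuliSpace.chart K i j k) = ModuliSpace.distinctLocus K i j k ∧
      IsOpen[(algConfig {l : Fin n // l ≠ i ∧ l ≠ j ∧ l ≠ k}).top]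
        (ModuliSpace.normalizedSet K i j k) ∧
      IsOpen[(holConfig {l : Fin n // l ≠ i ∧ l ≠ j ∧ l ≠ k}).top]
        (ModuliSpace.normalizedSet K i j k) ∧
      SpaceWithFunctions.IsOpenImmersion
        ((algConfig {l : Fin n // l ≠ i ∧ l ≠ j ∧ l ≠ k}).comap Subtype.val)
        (ModuliSpace.alg K) (ModuliSpace.chart K i j k) ∧
      SpaceWithFunctions.IsOpenImmersion
        ((holConfig {l : Fin n // l ≠ i ∧ l ≠ j ∧ l ≠ k}).comap Subtype.val)
        (ModuliSpace.hol K) (ModuliSpace.chart K i j k)) := by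
  have : Nonempty (ModuliSpace K) := ModuliSpace.nonempty hvertices hASD
  have hcompact := ModuliSpace.compactSpace hASD
  obtain ⟨cs, hman, hhol⟩ := ModuliSpace.exists_chartedSpace hASD
  exact ⟨hcompact, ModuliSpace.t2Space hASD,
    -- By compactness countably many charts suffice, and each chart domain is second countable.
    ChartedSpace.secondCountable_of_sigmaCompact (Fin (n - 3) → ℂ) (ModuliSpace K),
    ⟨cs, hman, hhol⟩, ModuliSpace.isSmoothVariety_alg hASD,
    ModuliSpace.exists_mem_distinctLocus hASD,
    fun i j k hij hjk hik => ⟨ModuliSpace.range_chart hij hjk hik,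
      SpaceWithFunctions.isGeometry_affine.isOpen_normalizedSet K,
      SpaceWithFunctions.isGeometry_holomorphic.isOpen_normalizedSet K,
      ModuliSpace.isOpenImmersion_chart SpaceWithFunctions.isGeometry_affine hij hjk hik,
      ModuliSpace.isOpenImmersion_chart SpaceWithFunctions.isGeometry_holomorphic hij hjk hik⟩⟩
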